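/- Let $\mathbf\Phi=\{\varphi_j\}_{j=1}^N$ ($N\ge 2$) be a self-similar system on $\mathbb R^m$, i.e. each $\varphi_j:\mathbb R^m\to\mathbb R^m$ satisfies $\|\varphi_j(x)-\varphi_j(y)\|=r_j\|x-y\|$ for all $x,y$, with $0<r_j<1$. Suppose that $\mathbf\Phi$ satisfies the open set condition: there is a nonempty open $V\subseteq\mathbb R^m$ such that $\varphi_j(V)\subseteq V$ for all $j$ and the sets $\varphi_j(V)$ are pairwise disjoint. Let $F$ be the attractor of $\mathbf\Phi$, the nonempty compact set with $F=\bigcup_{j}\varphi_j(F)$. For $x>0$ let $N_B(F,x)$ be the maximum number of pairwise disjoint closed balls with centers in $F$ and radius $x^{-1}$. If $F$ is infinite, let $M_1<M_2<\cdots$ be the values taken by $N_B(F,\cdot)$ on $(0,\infty)$, and put $l_n^{-1}=\sup\{x>0:N_B(F,x)=M_n\}$, $m_1=M_2$, and $m_n=M_{n+1}-M_n$ for $n\ge2$. The box-counting fractal string $\mathcal L_B$ of $F$ has the distinct lengths $l_n$ with multiplicities $m_n$; its dimension is $D_{\mathcal L_B}=\inf\{\alpha\in\mathbb R:\sum_n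 m_nl_n^\alpha<\infty\}$, and its zeta function is $\zeta_B(s)=\sum_n m_nl_n^s$ for $\operatorname{Re}s>D_{\mathcal L_B}$. A window is a set $W=\{s\in\mathbb C:\operatorname{Re}s\ge f(\operatorname{Im}s)\}$ with $f:\mathbb R\to[-\infty,D_{\mathcal L_B}]$ continuous; call it admissible if $\zeta_B$ has a meromorphic extension to an open connected set containing $W$, without a pole on the screen $\{s:\operatorname{Re}s=f(\operatorname{Im}s)\}$. The principal complex dimensions $\dim_{PC}\mathcal L_B$ (with respect to an admissible window $W$) are the poles $\omega\in W$ of this extension with $\operatorname{Re}\omega=D_{\mathcal L_B}$. Then $F$ is infinite; $D_{\mathcal L_B}$ equals the similarity dimension $D_{\mathbf r}$, the nonnegative real number with $\sum_{j=1}^N r_j^{D_{\mathbf r}}=1$; an admissible window exists; and, for every admissible window, $$\dim_{PC}\mathcal L_B\subseteq\mathcal S_{\mathbf r}:=\Big\{\omega\in\mathbb C:\sum_{j=1}^N r_j^{\omega}=1\Big\}.$$ -/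

import Mathlib

open Set Filter Topology

/-! ### Box-counting function -/

/-- `boxCount A x` is the maximum number of pairwise disjoint closed balls with centers in `A` and
radius `x⁻¹`. For bounded `A` and `x > 0` the set of admissible cardinalities is bounded
(`bddAbove_boxCount`), so the supremum is a maximum. -/
noncomputable def boxCount {m : ℕ} (A : Set (EuclideanSpace ℝ (Fin m))) (x : ℝ) : ℕ :=
  sSup {k : ℕ | ∃ t : Finset (EuclideanSpace ℝ (Fin m)), (t : Set (EuclideanSpace ℝ (Fin m))) ⊆ A ∧
    (t : Set (EuclideanSpace ℝ (Fin m))).PairwiseDisjoint (fun a => Metric.closedBall a x⁻¹) ∧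
    t.card = k}

/-- The values taken by the box-counting function on `(0, ∞)`. -/
def boxCountRange {m : ℕ} (A : Set (EuclideanSpace ℝ (Fin m))) : Set ℕ :=
  boxCount A '' Ioi 0

/-- The increasing enumeration `M 0 < M 1 < ⋯` of the values of the box-counting function
(indexed from `0`). -/
noncomputable def boxCountValue {m : ℕ} (A : Set (EuclideanSpace ℝ (Fin m))) (n : ℕ) : ℕ :=
  Nat.nth (· ∈ boxCountRange A) n

/-- The jump point `sup {x > 0 : boxCount A x = M n}`. -/
noncomputable def boxCountJump {m : ℕ} (A : Set (EuclideanSpace ℝ (Fin m))) (n : ℕ) : ℝ :=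
  sSup {x : ℝ | 0 < x ∧ boxCount A x = boxCountValue A n}

section BoxCount

theorem bddAbove_boxCount {m : ℕ} {A : Set (EuclideanSpace ℝ (Fin m))}
    (hA : Bornology.IsBounded A) {x : ℝ} (hx : 0 < x) :
    BddAbove {k : ℕ | ∃ t : Finset (EuclideanSpace ℝ (Fin m)),
      (t : Set (EuclideanSpace ℝ (Fin m))) ⊆ A ∧
      (t : Set (EuclideanSpace ℝ (Fin m))).PairwiseDisjoint (fun a => Metric.closedBall a x⁻¹) ∧
      t.card = k} := by
  classical
  have hx' : 0 < x⁻¹ := inv_pos.mpr hx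
  have htb : TotallyBounded A :=
    (Metric.isCompact_of_isClosed_isBounded isClosed_closure
      hA.closure).totallyBounded.subset subset_closure
  obtain ⟨T, hTfin, hT⟩ := Metric.totallyBounded_iff.1 htb x⁻¹ hx'
  refine ⟨hTfin.toFinset.card, ?_⟩
  rintro k ⟨t, htA, hd, rfl⟩
  have hex : ∀ a ∈ t, ∃ y ∈ hTfin.toFinset, dist a y < x⁻¹ := by
    intro a ha
    have := hT (htA ha)
    simp only [mem_iUnion, Metric.mem_ball] at this
    obtain ⟨y, hy, h⟩ := this
    exact ⟨y, by simpa using hy, h⟩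
  choose! c hc hcd using hex
  refine Finset.card_le_card_of_injOn c hc ?_
  intro a ha b hb hab
  by_contra hne
  have h1 : c a ∈ Metric.closedBall a x⁻¹ := by
    rw [Metric.mem_closedBall, dist_comm]; exact (hcd a ha).le
  have h2 : c a ∈ Metric.closedBall b x⁻¹ := by
    rw [hab, Metric.mem_closedBall, dist_comm]; exact (hcd b hb).le
  exact Set.disjoint_left.1 (hd ha hb hne) h1 h2

theorem le_boxCount {m : ℕ} {A : Set (EuclideanSpace ℝ (Fin m))}
    (hA : Bornology.IsBounded A) {x : ℝ} (hx : 0 < x) {t : Finset (EuclideanSpace ℝ (Fin m))}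
    (htA : (t : Set (EuclideanSpace ℝ (Fin m))) ⊆ A)
    (hd : (t : Set (EuclideanSpace ℝ (Fin m))).PairwiseDisjoint
      (fun a => Metric.closedBall a x⁻¹)) :
    t.card ≤ boxCount A x :=
  le_csSup (bddAbove_boxCount hA hx) ⟨t, htA, hd, rfl⟩

theorem exists_boxCount {m : ℕ} {A : Set (EuclideanSpace ℝ (Fin m))}
    (hA : Bornology.IsBounded A) {x : ℝ} (hx : 0 < x) :
    ∃ t : Finset (EuclideanSpace ℝ (Fin m)), (t : Set (EuclideanSpace ℝ (Fin m))) ⊆ A ∧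
      (t : Set (EuclideanSpace ℝ (Fin m))).PairwiseDisjoint (fun a => Metric.closedBall a x⁻¹) ∧
      t.card = boxCount A x := by
  have hne : {k : ℕ | ∃ t : Finset (EuclideanSpace ℝ (Fin m)),
      (t : Set (EuclideanSpace ℝ (Fin m))) ⊆ A ∧
      (t : Set (EuclideanSpace ℝ (Fin m))).PairwiseDisjoint (fun a => Metric.closedBall a x⁻¹) ∧
      t.card = k}.Nonempty := ⟨0, ∅, by simp, by simp, by simp⟩
  exact Nat.sSup_mem hne (bddAbove_boxCount hA hx)

theorem boxCount_mono {m : ℕ} {A : Set (EuclideanSpace ℝ (Fin m))}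
    (hA : Bornology.IsBounded A) {x y : ℝ} (hx : 0 < x) (hxy : x ≤ y) :
    boxCount A x ≤ boxCount A y := by
  obtain ⟨t, htA, hd, hc⟩ := exists_boxCount hA hx
  rw [← hc]
  refine le_boxCount hA (hx.trans_le hxy) htA (hd.mono_on fun a _ => ?_)
  exact Metric.closedBall_subset_closedBall (inv_anti₀ hx hxy)

theorem lt_of_boxCount_lt {m : ℕ} {A : Set (EuclideanSpace ℝ (Fin m))}
    (hA : Bornology.IsBounded A) {x y : ℝ} (hy : 0 < y) (h : boxCount A x < boxCount A y) :
    x < y := by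
  by_contra hle
  exact absurd (boxCount_mono hA hy (not_lt.1 hle)) (not_le.2 h)

/-- A maximal disjoint family of closed balls stays disjoint if the radius grows slightly. -/
theorem exists_lt_boxCount_eq {m : ℕ} {A : Set (EuclideanSpace ℝ (Fin m))}
    (hA : Bornology.IsBounded A) {y : ℝ} (hy : 0 < y) :
    ∃ z, 0 < z ∧ z < y ∧ boxCount A y ≤ boxCount A z := by
  obtain ⟨t, htA, hd, hc⟩ := exists_boxCount hA hy
  have hcont : Tendsto (fun z : ℝ => z⁻¹ + z⁻¹) (𝓝[<] y) (𝓝 (y⁻¹ + y⁻¹)) := by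
    have : ContinuousAt (fun z : ℝ => z⁻¹ + z⁻¹) y :=
      (continuousAt_inv₀ hy.ne').add (continuousAt_inv₀ hy.ne')
    exact this.tendsto.mono_left nhdsWithin_le_nhds
  have hev : ∀ᶠ z in 𝓝[<] y, ∀ a ∈ t, ∀ b ∈ t, a ≠ b → z⁻¹ + z⁻¹ < dist a b := by
    rw [Filter.eventually_all_finset]
    intro a ha
    rw [Filter.eventually_all_finset]
    intro b hb
    by_cases hab : a = b
    · exact Eventually.of_forall fun z h => absurd hab h
    · have h1 : y⁻¹ + y⁻¹ < dist a b :=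
        (disjoint_closedBall_closedBall_iff (inv_pos.2 hy).le (inv_pos.2 hy).le).1 (hd ha hb hab)
      filter_upwards [hcont.eventually_lt_const h1] with z hz _ using hz
  have hpos : ∀ᶠ z in 𝓝[<] y, 0 < z := nhdsWithin_le_nhds (lt_mem_nhds hy)
  obtain ⟨z, hz1, hz2, hz3⟩ := (hev.and (hpos.and self_mem_nhdsWithin)).exists
  refine ⟨z, hz2, hz3, hc ▸ le_boxCount hA hz2 htA ?_⟩
  intro a ha b hb hab
  exact (disjoint_closedBall_closedBall_iff (inv_pos.2 hz2).le (inv_pos.2 hz2).le).2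
    (hz1 a ha b hb hab)

theorem exists_le_boxCount {m : ℕ} {A : Set (EuclideanSpace ℝ (Fin m))}
    (hA : Bornology.IsBounded A) (hi : A.Infinite) (k : ℕ) :
    ∃ x, 0 < x ∧ k ≤ boxCount A x := by
  obtain ⟨t, htA, hc⟩ := hi.exists_subset_card_eq k
  have hcont : Tendsto (fun z : ℝ => z⁻¹ + z⁻¹) atTop (𝓝 0) := by
    simpa using (tendsto_inv_atTop_zero (𝕜 := ℝ)).add (tendsto_inv_atTop_zero (𝕜 := ℝ))
  have hev : ∀ᶠ z in (atTop : Filter ℝ), ∀ a ∈ t, ∀ b ∈ t, a ≠ b → z⁻¹ + z⁻¹ < dist a b := by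
    rw [Filter.eventually_all_finset]
    intro a ha
    rw [Filter.eventually_all_finset]
    intro b hb
    by_cases hab : a = b
    · exact Eventually.of_forall fun z h => absurd hab h
    · filter_upwards [hcont.eventually_lt_const (dist_pos.2 hab)] with z hz _ using hz
  obtain ⟨z, hz1, hz2⟩ := (hev.and (eventually_gt_atTop 0)).exists
  refine ⟨z, hz2, hc ▸ le_boxCount hA hz2 htA ?_⟩
  intro a ha b hb hab
  exact (disjoint_closedBall_closedBall_iff (inv_pos.2 hz2).le (inv_pos.2 hz2).le).2
    (hz1 a ha b hb hab)

theorem boxCountRange_infinite {m : ℕ} {A : Set (EuclideanSpace ℝ (Fin m))}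
    (hA : Bornology.IsBounded A) (hi : A.Infinite) : (boxCountRange A).Infinite := by
  refine Set.infinite_of_not_bddAbove ?_
  rintro ⟨b, hb⟩
  obtain ⟨x, hx, h⟩ := exists_le_boxCount hA hi (b + 1)
  have := hb ⟨x, hx, rfl⟩
  omega

theorem boxCountValue_strictMono {m : ℕ} {A : Set (EuclideanSpace ℝ (Fin m))}
    (hA : Bornology.IsBounded A) (hi : A.Infinite) : StrictMono (boxCountValue A) :=
  Nat.nth_strictMono (boxCountRange_infinite hA hi)

theorem exists_boxCount_eq_value {m : ℕ} {A : Set (EuclideanSpace ℝ (Fin m))}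
    (hA : Bornology.IsBounded A) (hi : A.Infinite) (n : ℕ) :
    ∃ x, 0 < x ∧ boxCount A x = boxCountValue A n :=
  Nat.nth_mem_of_infinite (boxCountRange_infinite hA hi) n

theorem le_boxCountJump {m : ℕ} {A : Set (EuclideanSpace ℝ (Fin m))}
    (hA : Bornology.IsBounded A) (hi : A.Infinite) {n : ℕ} {x : ℝ} (hx : 0 < x)
    (h : boxCount A x = boxCountValue A n) : x ≤ boxCountJump A n := by
  refine le_csSup ?_ ⟨hx, h⟩
  obtain ⟨y, hy, hy'⟩ := exists_boxCount_eq_value hA hi (n + 1)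
  refine ⟨y, fun z hz => (lt_of_boxCount_lt hA hy ?_).le⟩
  rw [hz.2, hy']
  exact boxCountValue_strictMono hA hi (Nat.lt_succ_self n)

theorem boxCountJump_pos {m : ℕ} {A : Set (EuclideanSpace ℝ (Fin m))}
    (hA : Bornology.IsBounded A) (hi : A.Infinite) (n : ℕ) : 0 < boxCountJump A n := by
  obtain ⟨x, hx, h⟩ := exists_boxCount_eq_value hA hi n
  exact hx.trans_le (le_boxCountJump hA hi hx h)

theorem boxCountJump_strictMono {m : ℕ} {A : Set (EuclideanSpace ℝ (Fin m))}
    (hA : Bornology.IsBounded A) (hi : A.Infinite) : StrictMono (boxCountJump A) := by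
  refine strictMono_nat_of_lt_succ fun n => ?_
  obtain ⟨y, hy, hy'⟩ := exists_boxCount_eq_value hA hi (n + 1)
  obtain ⟨z, hz, hzy, hle⟩ := exists_lt_boxCount_eq hA hy
  refine lt_of_le_of_lt ?_ (hzy.trans_le (le_boxCountJump hA hi hy hy'))
  refine csSup_le (exists_boxCount_eq_value hA hi n) fun w hw => (lt_of_boxCount_lt hA hz ?_).le
  rw [hw.2]
  exact (boxCountValue_strictMono hA hi (Nat.lt_succ_self n)).trans_le (hy' ▸ hle)

theorem tendsto_boxCountJump {m : ℕ} {A : Set (EuclideanSpace ℝ (Fin m))}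
    (hA : Bornology.IsBounded A) (hi : A.Infinite) : Tendsto (boxCountJump A) atTop atTop := by
  refine tendsto_atTop.2 fun b => ?_
  filter_upwards [(boxCountValue_strictMono hA hi).tendsto_atTop.eventually_gt_atTop
    (boxCount A b)] with n hn
  obtain ⟨x, hx, h⟩ := exists_boxCount_eq_value hA hi n
  exact (lt_of_boxCount_lt hA hx (h ▸ hn)).le.trans (le_boxCountJump hA hi hx h)

end BoxCount

/-! ### Fractal strings, zeta functions and complex dimensions -/

/-- A fractal string, i.e. a nonincreasing sequence of positive reals tending to `0`, recorded by
the strictly decreasing sequence `len` of its distinct lengths and their multiplicities `mult`. -/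
structure FractalString where
  len : ℕ → ℝ
  mult : ℕ → ℕ
  len_pos : ∀ n, 0 < len n
  len_strictAnti : StrictAnti len
  len_tendsto : Tendsto len atTop (𝓝 0)
  mult_pos : ∀ n, 0 < mult n

namespace FractalString

/-- The dimension (abscissa of convergence)
`inf {α ∈ ℝ : ∑ m_n l_n ^ α < ∞}`, as an extended real number. -/
noncomputable def dimension (L : FractalString) : EReal :=
  sInf ((fun α : ℝ => (α : EReal)) '' {α : ℝ | Summable fun n => (L.mult n : ℝ) * L.len n ^ α})

/-- The Dirichlet series `∑ m_n l_n ^ s`, which defines the geometric zeta function on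
`Re s > L.dimension`. -/
noncomputable def zeta (L : FractalString) (s : ℂ) : ℂ :=
  ∑' n, (L.mult n : ℂ) * (L.len n : ℂ) ^ s

end FractalString

/-- The screen `{f(t) + i t : t ∈ ℝ}` defined by a function `f : ℝ → [-∞, ∞]`. -/
def screen (f : ℝ → EReal) : Set ℂ := {s : ℂ | (s.re : EReal) = f s.im}

/-- The window `{s : Re s ≥ f (Im s)}` to the right of the screen defined by `f`. -/
def window (f : ℝ → EReal) : Set ℂ := {s : ℂ | f s.im ≤ (s.re : EReal)}

/-- The meromorphic function `g` has a pole at `ω`. -/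
def HasPole (g : ℂ → ℂ) (ω : ℂ) : Prop := MeromorphicAt g ω ∧ meromorphicOrderAt g ω < 0

namespace FractalString

/-- `g` is a meromorphic extension of the geometric zeta function of `L` to the open connected set
`U`, which contains the window of the screen defined by the continuous function
`f : ℝ → [-∞, L.dimension]`, and `g` has no pole on that screen. -/
structure IsAdmissible (L : FractalString) (f : ℝ → EReal) (U : Set ℂ) (g : ℂ → ℂ) : Prop where
  continuous : Continuous f
  le_dimension : ∀ t, f t ≤ L.dimension
  isOpen : IsOpen U
  isConnected : IsConnected U
  window_subset : window f ⊆ U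
  meromorphicOn : MeromorphicOn g U
  eq_zeta : ∀ s : ℂ, L.dimension < (s.re : EReal) → g s = L.zeta s
  no_pole : ∀ s ∈ screen f, ¬ HasPole g s

/-- The visible complex dimensions in the window of `f`: the poles there of the meromorphic
extension `g` of the geometric zeta function. -/
def visibleComplexDimensions (f : ℝ → EReal) (g : ℂ → ℂ) : Set ℂ :=
  {ω ∈ window f | HasPole g ω}

/-- The principal complex dimensions of `L`: the visible complex dimensions with real part
`L.dimension`. -/
def principalComplexDimensions (L : FractalString) (f : ℝ → EReal) (g : ℂ → ℂ) : Set ℂ :=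
  {ω ∈ visibleComplexDimensions f g | (ω.re : EReal) = L.dimension}

end FractalString

/-- The box-counting fractal string of a bounded infinite set `A`: with `M 0 < M 1 < ⋯` the values
of the box-counting function, its lengths are `l n = (sup {x > 0 : boxCount A x = M n})⁻¹`, with
multiplicities `M 1` for `n = 0` and `M (n + 1) - M n` for `n ≥ 1`. -/
noncomputable def boxCountingString {m : ℕ} (A : Set (EuclideanSpace ℝ (Fin m)))
    (hA : Bornology.IsBounded A) (hi : A.Infinite) : FractalString where
  len n := (boxCountJump A n)⁻¹
  mult n := if n = 0 then boxCountValue A 1 else boxCountValue A (n + 1) - boxCountValue A n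
  len_pos n := inv_pos.2 (boxCountJump_pos hA hi n)
  len_strictAnti _ _ h :=
    inv_strictAnti₀ (boxCountJump_pos hA hi _) (boxCountJump_strictMono hA hi h)
  len_tendsto := tendsto_inv_atTop_zero.comp (tendsto_boxCountJump hA hi)
  mult_pos n := by
    have h0 := boxCountValue_strictMono hA hi (Nat.lt_succ_self 0)
    have h1 := boxCountValue_strictMono hA hi (Nat.lt_succ_self n)
    simp only [Nat.succ_eq_add_one, zero_add] at h0 h1
    split_ifs <;> omega

/-! ### Self-similar systems -/

/-- A self-similar system on `ℝ^m`: `N ≥ 2` contracting similarities `map j` with scaling ratios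
`ratio j ∈ (0, 1)`. -/
structure SelfSimilarSystem (m N : ℕ) where
  two_le : 2 ≤ N
  map : Fin N → EuclideanSpace ℝ (Fin m) → EuclideanSpace ℝ (Fin m)
  ratio : Fin N → ℝ
  ratio_pos : ∀ j, 0 < ratio j
  ratio_lt_one : ∀ j, ratio j < 1
  dist_map : ∀ j x y, dist (map j x) (map j y) = ratio j * dist x y

namespace SelfSimilarSystem

/-- `F` is the attractor: the nonempty compact set with `F = ⋃ j, φ_j(F)`. -/
structure IsAttractor {m N : ℕ} (Φ : SelfSimilarSystem m N)
    (F : Set (EuclideanSpace ℝ (Fin m))) : Prop where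
  nonempty : F.Nonempty
  isCompact : IsCompact F
  iUnion_image : ⋃ j, Φ.map j '' F = F

/-- The open set condition. -/
def OpenSetCondition {m N : ℕ} (Φ : SelfSimilarSystem m N) : Prop :=
  ∃ V : Set (EuclideanSpace ℝ (Fin m)), V.Nonempty ∧ IsOpen V ∧
    (∀ j, Φ.map j '' V ⊆ V) ∧ Pairwise fun j k => Disjoint (Φ.map j '' V) (Φ.map k '' V)

end SelfSimilarSystem

/-- `D` is the similarity dimension of the scaling vector `r`, i.e. the nonnegative real solution
of the Moran equation (it is unique for a scaling vector with at least two entries in `(0, 1)`). -/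
def IsSimilarityDimension {N : ℕ} (r : Fin N → ℝ) (D : ℝ) : Prop :=
  0 ≤ D ∧ ∑ j, r j ^ D = 1

/-- The complex solutions of the Moran equation `∑ j, r_j ^ ω = 1`. -/
def moranSolutions {N : ℕ} (r : Fin N → ℝ) : Set ℂ :=
  {ω : ℂ | ∑ j, (r j : ℂ) ^ ω = 1}

/-! ### Further properties of the box-counting function -/

section BoxCount

variable {m : ℕ} {A B : Set (EuclideanSpace ℝ (Fin m))} {x : ℝ}

/-! Write N(x) for `boxCount F x` and D for the similarity dimension. A similarity of ratio r turns
N(x) into N(r x) and F is the union of its first-level pieces, so N(x) ≤ ∑ N(r_j x)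
(`boxCount_image`, `boxCount_le_sum`). Comparing N with powers of x gives N(x) = O(x ^ D).

The heart of the proof is that the defect ∑ N(r_j x) - N(x) is O(x ^ d) for some d < D
(`exists_sum_boxCount_sub_le`). By `sum_boxCount_le` it only counts points of one piece that are
within 2 / x of another piece. The open set condition provides a word w whose copy in every cylinder
stays away from the other first-level pieces (`exists_separated_word`, by a maximality argument).
The counted points therefore avoid these copies at all scales down to about 1 / x. Dropping one word
of length |w| pushes the Moran sum at D below 1, so a renewal argument bounds such sets with a
smaller exponent (`exists_boxCount_le_of_avoids`).

The zeta function is s ∫ x ^ (-s - 1) N(x) dx, with N cut off below its first jump. The renewal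
equation becomes (∑ r_j ^ s - 1) · Mellin(N) = Mellin(defect), whose right side is holomorphic for
Re s > d. Hence `zetaExtension` continues zeta past the line Re s = D, with poles only at solutions
of the Moran equation. Any other extension agrees with it for Re s > D, hence has the same order at
each point of that line where it is meromorphic.

That the abscissa of convergence is D follows from N(x) = O(x ^ D) and the bounds N(x) ≥ c x ^ s for
0 ≤ s < D, which come from the mutually separated cylinders of words ending in w
(`exists_rpow_le_boxCount`). -/

theorem boxCount_mono_set (hB : Bornology.IsBounded B) (h : A ⊆ B) (hx : 0 < x) :
    boxCount A x ≤ boxCount B x := by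
  obtain ⟨t, htA, hd, hc⟩ := exists_boxCount (hB.subset h) hx
  exact hc ▸ le_boxCount hB hx (htA.trans h) hd

theorem boxCount_le_sum {ι : Type*} [Fintype ι] {B : ι → Set (EuclideanSpace ℝ (Fin m))}
    (hB : ∀ i, Bornology.IsBounded (B i)) (h : A ⊆ ⋃ i, B i) (hx : 0 < x) :
    boxCount A x ≤ ∑ i, boxCount (B i) x := by
  classical
  have hA : Bornology.IsBounded A := (Bornology.isBounded_iUnion.2 hB).subset h
  obtain ⟨t, htA, hd, hc⟩ := exists_boxCount hA hx
  have ht : t ⊆ Finset.univ.biUnion fun i => t.filter (· ∈ B i) := by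
    intro a ha
    obtain ⟨i, hi⟩ := mem_iUnion.1 (h (htA ha))
    simp only [Finset.mem_biUnion, Finset.mem_filter, Finset.mem_univ, true_and]
    exact ⟨i, ha, hi⟩
  rw [← hc]
  refine (Finset.card_le_card ht).trans (Finset.card_biUnion_le.trans ?_)
  refine Finset.sum_le_sum fun i _ => le_boxCount (hB i) hx ?_ (hd.subset ?_)
  · intro a ha
    exact (Finset.mem_filter.1 ha).2
  · exact Finset.coe_subset.2 (Finset.filter_subset _ _)

/-- Replaces balls by a condition on the distances of the centres, which similarities transform in
an obvious way. -/
theorem pairwiseDisjoint_closedBall_iff (hx : 0 < x) (s : Set (EuclideanSpace ℝ (Fin m))) :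
    s.PairwiseDisjoint (fun a => Metric.closedBall a x⁻¹) ↔
      ∀ a ∈ s, ∀ b ∈ s, a ≠ b → 2 / x < dist a b := by
  have h2 : x⁻¹ + x⁻¹ = 2 / x := by ring
  have hx' : 0 ≤ x⁻¹ := (inv_pos.2 hx).le
  constructor
  · intro h a ha b hb hab
    rw [← h2]
    exact (disjoint_closedBall_closedBall_iff hx' hx').1 (h ha hb hab)
  · intro h a ha b hb hab
    refine (disjoint_closedBall_closedBall_iff hx' hx').2 ?_
    rw [h2]
    exact h a ha b hb hab

/-- A similarity of ratio `r` turns the box-counting function at `x` into that at `r * x`. -/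
theorem boxCount_image {φ : EuclideanSpace ℝ (Fin m) → EuclideanSpace ℝ (Fin m)} {r : ℝ}
    (hr : 0 < r) (hφ : ∀ a b, dist (φ a) (φ b) = r * dist a b) (hA : Bornology.IsBounded A)
    (hx : 0 < x) : boxCount (φ '' A) x = boxCount A (r * x) := by
  classical
  have hinj : Function.Injective φ := by
    intro a b hab
    have := hφ a b
    rw [hab, dist_self] at this
    exact dist_eq_zero.1 ((mul_eq_zero.1 this.symm).resolve_left hr.ne')
  have hlip : LipschitzWith r.toNNReal φ := by
    refine LipschitzWith.of_dist_le_mul fun a b => ?_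
    rw [hφ, Real.coe_toNNReal _ hr.le]
  have hA' : Bornology.IsBounded (φ '' A) := hlip.isBounded_image hA
  have hrx : 0 < r * x := mul_pos hr hx
  have key : ∀ a b, 2 / x < dist (φ a) (φ b) ↔ 2 / (r * x) < dist a b := by
    intro a b
    rw [hφ, div_lt_iff₀ hx, div_lt_iff₀ hrx]
    ring_nf
  apply le_antisymm
  · obtain ⟨t, htA, hd, hc⟩ := exists_boxCount hA' hx
    obtain ⟨u, huA, rfl⟩ := Finset.subset_set_image_iff.1 htA
    rw [← hc, Finset.card_image_of_injective _ hinj]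
    refine le_boxCount hA hrx huA ((pairwiseDisjoint_closedBall_iff hrx _).2 ?_)
    intro a ha b hb hab
    refine (key a b).1 ((pairwiseDisjoint_closedBall_iff hx _).1 hd _ ?_ _ ?_ (hinj.ne hab))
    · exact Finset.mem_coe.2 (Finset.mem_image_of_mem _ ha)
    · exact Finset.mem_coe.2 (Finset.mem_image_of_mem _ hb)
  · obtain ⟨t, htA, hd, hc⟩ := exists_boxCount hA hrx
    rw [← hc, ← Finset.card_image_of_injective _ hinj]
    refine le_boxCount hA' hx ?_ ((pairwiseDisjoint_closedBall_iff hx _).2 ?_)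
    · rw [Finset.coe_image]
      exact image_mono htA
    · rw [Finset.coe_image]
      rintro _ ⟨a, ha, rfl⟩ _ ⟨b, hb, rfl⟩ hab
      exact (key a b).2 ((pairwiseDisjoint_closedBall_iff hrx _).1 hd a ha b hb
        fun h => hab (h ▸ rfl))

/-- The box-counting function is superadditive up to the contribution of the points of a part that
are close to another part. -/
theorem sum_boxCount_le {ι : Type*} [Fintype ι] {B : ι → Set (EuclideanSpace ℝ (Fin m))}
    (hA : Bornology.IsBounded A) (h : ∀ i, B i ⊆ A) (hx : 0 < x) :
    ∑ i, boxCount (B i) x ≤ boxCount A x +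
      ∑ i, boxCount {p ∈ B i | ∃ j, j ≠ i ∧ ∃ q ∈ B j, dist p q ≤ 2 / x} x := by
  classical
  choose t htB hd hc using fun i => exists_boxCount (hA.subset (h i)) hx
  set C : ι → Set (EuclideanSpace ℝ (Fin m)) :=
    fun i => {p ∈ B i | ∃ j, j ≠ i ∧ ∃ q ∈ B j, dist p q ≤ 2 / x} with hC
  have hsplit : ∀ i, boxCount (B i) x =
      ((t i).filter (· ∉ C i)).card + ((t i).filter (· ∈ C i)).card := by
    intro i
    rw [← hc, add_comm, Finset.card_filter_add_card_filter_not]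
  -- Centres outside `C i` are more than 2 / x from every other part, so optimal families of the
  -- parts can be merged once the centres in `C i` are removed.
  have hsep : ∀ i j, i ≠ j → ∀ p ∈ (t i).filter (· ∉ C i), ∀ q ∈ t j, 2 / x < dist p q := by
    intro i j hij p hp q hq
    rw [Finset.mem_filter] at hp
    by_contra hle
    exact hp.2 ⟨htB i hp.1, j, hij.symm, q, htB j hq, not_lt.1 hle⟩
  have hpos : 0 < 2 / x := by positivity
  have h1 : ∑ i, ((t i).filter (· ∉ C i)).card ≤ boxCount A x := by
    rw [← Finset.card_biUnion]
    · refine le_boxCount hA hx ?_ ((pairwiseDisjoint_closedBall_iff hx _).2 ?_)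
      · intro p hp
        simp only [Finset.coe_biUnion, mem_iUnion] at hp
        obtain ⟨i, -, hp⟩ := hp
        exact h i (htB i (Finset.mem_filter.1 hp).1)
      · intro p hp q hq hpq
        simp only [Finset.coe_biUnion, mem_iUnion] at hp hq
        obtain ⟨i, -, hp⟩ := hp
        obtain ⟨j, -, hq⟩ := hq
        by_cases hij : i = j
        · subst hij
          exact (pairwiseDisjoint_closedBall_iff hx _).1 (hd i) p (Finset.mem_filter.1 hp).1 q
            (Finset.mem_filter.1 hq).1 hpq
        · exact hsep i j hij p hp q (Finset.mem_filter.1 hq).1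
    · intro i _ j _ hij
      refine Finset.disjoint_left.2 fun p hp hq => ?_
      have := hsep i j hij p hp p (Finset.mem_filter.1 hq).1
      rw [dist_self] at this
      exact lt_asymm hpos this
  have h2 : ∀ i, ((t i).filter (· ∈ C i)).card ≤ boxCount (C i) x := by
    intro i
    refine le_boxCount (hA.subset ((sep_subset _ _).trans (h i))) hx ?_ ((hd i).subset ?_)
    · intro p hp
      exact (Finset.mem_filter.1 hp).2
    · exact Finset.coe_subset.2 (Finset.filter_subset _ _)
  rw [Finset.sum_congr rfl fun i _ => hsplit i, Finset.sum_add_distrib]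
  exact add_le_add h1 (Finset.sum_le_sum fun i _ => h2 i)

theorem one_le_boxCount (hA : Bornology.IsBounded A) (hne : A.Nonempty) (hx : 0 < x) :
    1 ≤ boxCount A x := by
  obtain ⟨a, ha⟩ := hne
  have := le_boxCount hA hx (t := {a}) (by simpa using ha) (by simp)
  simpa using this

end BoxCount

/-! ### Words in the maps of a self-similar system -/

namespace SelfSimilarSystem

variable {m N : ℕ} (Φ : SelfSimilarSystem m N)

/-- The composition of the maps along a word. -/
def wordMap : List (Fin N) → EuclideanSpace ℝ (Fin m) → EuclideanSpace ℝ (Fin m)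
  | [] => id
  | j :: w => Φ.map j ∘ wordMap w

/-- The scaling ratio of a word. -/
noncomputable def wordRatio (w : List (Fin N)) : ℝ := (w.map Φ.ratio).prod

@[simp] theorem wordMap_nil (p : EuclideanSpace ℝ (Fin m)) : Φ.wordMap [] p = p := rfl

@[simp] theorem wordMap_cons (j : Fin N) (w : List (Fin N)) (p : EuclideanSpace ℝ (Fin m)) :
    Φ.wordMap (j :: w) p = Φ.map j (Φ.wordMap w p) := rfl

@[simp] theorem wordRatio_nil : Φ.wordRatio [] = 1 := rfl

@[simp] theorem wordRatio_cons (j : Fin N) (w : List (Fin N)) :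
    Φ.wordRatio (j :: w) = Φ.ratio j * Φ.wordRatio w := by simp [wordRatio]

@[simp] theorem wordRatio_append (v w : List (Fin N)) :
    Φ.wordRatio (v ++ w) = Φ.wordRatio v * Φ.wordRatio w := by simp [wordRatio]

theorem wordMap_append (v w : List (Fin N)) (p : EuclideanSpace ℝ (Fin m)) :
    Φ.wordMap (v ++ w) p = Φ.wordMap v (Φ.wordMap w p) := by
  induction v with
  | nil => rfl
  | cons j v ih => simp [ih]

theorem wordRatio_pos (w : List (Fin N)) : 0 < Φ.wordRatio w := by
  induction w with
  | nil => simp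
  | cons j w ih => simpa using mul_pos (Φ.ratio_pos j) ih

theorem wordRatio_le_one (w : List (Fin N)) : Φ.wordRatio w ≤ 1 := by
  induction w with
  | nil => simp
  | cons j w ih =>
    simpa using mul_le_one₀ (Φ.ratio_lt_one j).le (Φ.wordRatio_pos w).le ih

theorem dist_wordMap (w : List (Fin N)) (p q : EuclideanSpace ℝ (Fin m)) :
    dist (Φ.wordMap w p) (Φ.wordMap w q) = Φ.wordRatio w * dist p q := by
  induction w with
  | nil => simp
  | cons j w ih => simp [Φ.dist_map, ih, mul_assoc]

theorem wordMap_injective (w : List (Fin N)) : Function.Injective (Φ.wordMap w) := by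
  intro a b hab
  have := Φ.dist_wordMap w a b
  rw [hab, dist_self] at this
  exact dist_eq_zero.1 ((mul_eq_zero.1 this.symm).resolve_left (Φ.wordRatio_pos w).ne')

/-- Divided by its ratio the map is an isometry. Isometries into a strictly convex space are affine,
and equal finite dimensions make them onto. -/
theorem wordMap_surjective (w : List (Fin N)) : Function.Surjective (Φ.wordMap w) := by
  have hr := Φ.wordRatio_pos w
  have hiso : Isometry fun p => (Φ.wordRatio w)⁻¹ • Φ.wordMap w p := by
    refine Isometry.of_dist_eq fun p q => ?_
    rw [dist_smul₀, Φ.dist_wordMap, norm_inv, Real.norm_of_nonneg hr.le,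
      inv_mul_cancel_left₀ hr.ne']
  have hsurj : Function.Surjective hiso.affineIsometryOfStrictConvexSpace :=
    (hiso.affineIsometryOfStrictConvexSpace.toAffineIsometryEquiv rfl).surjective
  intro q
  obtain ⟨p, hp⟩ := hsurj ((Φ.wordRatio w)⁻¹ • q)
  refine ⟨p, ?_⟩
  have : (Φ.wordRatio w)⁻¹ • Φ.wordMap w p = (Φ.wordRatio w)⁻¹ • q := hp
  exact smul_right_injective _ (inv_pos.2 hr).ne' this

theorem ball_subset_wordMap_image (w : List (Fin N)) (p : EuclideanSpace ℝ (Fin m)) (ρ : ℝ) :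
    Metric.ball (Φ.wordMap w p) (Φ.wordRatio w * ρ) ⊆ Φ.wordMap w '' Metric.ball p ρ := by
  intro q hq
  obtain ⟨q, rfl⟩ := Φ.wordMap_surjective w q
  rw [Metric.mem_ball, Φ.dist_wordMap] at hq
  exact ⟨q, lt_of_mul_lt_mul_left hq (Φ.wordRatio_pos w).le, rfl⟩

theorem wordMap_mapsTo {V : Set (EuclideanSpace ℝ (Fin m))} (hV : ∀ j, Φ.map j '' V ⊆ V)
    (w : List (Fin N)) : MapsTo (Φ.wordMap w) V V := by
  induction w with
  | nil => exact mapsTo_id V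
  | cons j w ih => exact fun p hp => hV j ⟨_, ih hp, rfl⟩

theorem IsAttractor.image_subset {Φ : SelfSimilarSystem m N} {F : Set (EuclideanSpace ℝ (Fin m))}
    (hF : Φ.IsAttractor F) (j : Fin N) : Φ.map j '' F ⊆ F := by
  conv_rhs => rw [← hF.iUnion_image]
  exact subset_iUnion (fun j => Φ.map j '' F) j

theorem IsAttractor.mapsTo {Φ : SelfSimilarSystem m N} {F : Set (EuclideanSpace ℝ (Fin m))}
    (hF : Φ.IsAttractor F) (w : List (Fin N)) : MapsTo (Φ.wordMap w) F F :=
  Φ.wordMap_mapsTo hF.image_subset w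

theorem IsAttractor.exists_map_eq {Φ : SelfSimilarSystem m N}
    {F : Set (EuclideanSpace ℝ (Fin m))} (hF : Φ.IsAttractor F) {p : EuclideanSpace ℝ (Fin m)}
    (hp : p ∈ F) : ∃ j, ∃ q ∈ F, Φ.map j q = p := by
  rw [← hF.iUnion_image] at hp
  simpa using hp

theorem exists_ratio_bounds : ∃ a b : ℝ, 0 < a ∧ b < 1 ∧ 0 < b ∧
    ∀ j, a ≤ Φ.ratio j ∧ Φ.ratio j ≤ b := by
  have : Nonempty (Fin N) := ⟨⟨0, by have := Φ.two_le; omega⟩⟩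
  obtain ⟨i, hi⟩ := Finite.exists_min Φ.ratio
  obtain ⟨j, hj⟩ := Finite.exists_max Φ.ratio
  exact ⟨Φ.ratio i, Φ.ratio j, Φ.ratio_pos i, Φ.ratio_lt_one j, Φ.ratio_pos j,
    fun k => ⟨hi k, hj k⟩⟩

/-- A point of the attractor lies in a cylinder of prescribed size. -/
theorem IsAttractor.exists_word {Φ : SelfSimilarSystem m N}
    {F : Set (EuclideanSpace ℝ (Fin m))} (hF : Φ.IsAttractor F) {a : ℝ}
    (ha : ∀ j, a ≤ Φ.ratio j) {δ : ℝ} (hδ : 0 < δ) {t : ℝ} (ht : 0 < t) (hat : a * δ ≤ t)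
    {p : EuclideanSpace ℝ (Fin m)} (hp : p ∈ F) :
    ∃ u, ∃ q ∈ F, Φ.wordMap u q = p ∧ a * δ ≤ t * Φ.wordRatio u ∧ t * Φ.wordRatio u ≤ δ := by
  obtain ⟨_, b, _, hb1, hb0, hb⟩ := Φ.exists_ratio_bounds
  -- Induct on a number of letters sufficient to reach size δ. The descent stops as soon as the size
  -- is at most δ; the last letter multiplies it by at least `a`, so it is still at least `a * δ`.
  obtain ⟨k, hk⟩ : ∃ k : ℕ, t * b ^ k ≤ δ := by
    obtain ⟨k, hk⟩ := exists_pow_lt_of_lt_one (div_pos hδ ht) hb1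
    exact ⟨k, by rw [lt_div_iff₀ ht] at hk; linarith⟩
  induction k generalizing t p with
  | zero => exact ⟨[], p, hp, rfl, by simpa using hat, by simpa using hk⟩
  | succ k ih =>
    by_cases htδ : t ≤ δ
    · exact ⟨[], p, hp, rfl, by simpa using hat, by simpa using htδ⟩
    · obtain ⟨j, q, hq, rfl⟩ := hF.exists_map_eq hp
      have h1 : a * δ ≤ t * Φ.ratio j :=
        (mul_le_mul_of_nonneg_right (ha j) hδ.le).trans
          ((mul_comm _ _).trans_le
            (mul_le_mul_of_nonneg_right (not_le.1 htδ).le (Φ.ratio_pos j).le))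
      have h2 : t * Φ.ratio j * b ^ k ≤ δ := by
        refine le_trans ?_ hk
        rw [pow_succ', mul_assoc]
        exact mul_le_mul_of_nonneg_left
          (mul_le_mul_of_nonneg_right (hb j).2 (by positivity)) ht.le
      obtain ⟨u, q', hq', rfl, h3, h4⟩ := ih (mul_pos ht (Φ.ratio_pos j)) h1 hq h2
      exact ⟨j :: u, q', hq', rfl, by simpa [mul_assoc] using h3, by simpa [mul_assoc] using h4⟩

/-- Cylinders that have about the size of a given cylinder and are close to it, with disjoint
images of the open set `V`. -/
structure IsNeighbourFamily (F V : Set (EuclideanSpace ℝ (Fin m))) (a : ℝ) (w : List (Fin N))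
    (S : Finset (List (Fin N))) : Prop where
  le_ratio : ∀ s ∈ S, a * Φ.wordRatio w ≤ Φ.wordRatio s
  ratio_le : ∀ s ∈ S, Φ.wordRatio s ≤ Φ.wordRatio w
  close : ∀ s ∈ S, ∃ p ∈ F, ∃ q ∈ F,
    dist (Φ.wordMap s p) (Φ.wordMap w q) ≤ Φ.wordRatio w
  disjoint : ∀ s ∈ S, ∀ t ∈ S, s ≠ t → Disjoint (Φ.wordMap s '' V) (Φ.wordMap t '' V)

/-- A volume argument bounds the number of neighbours of a cylinder. -/
theorem exists_card_le_of_isNeighbourFamily {F V : Set (EuclideanSpace ℝ (Fin m))}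
    (hF : Bornology.IsBounded F) (hV : IsOpen V) (hVne : V.Nonempty) {a : ℝ} (ha : 0 < a) :
    ∃ k : ℕ, ∀ w S, Φ.IsNeighbourFamily F V a w S → S.card ≤ k := by
  classical
  obtain ⟨v, hv⟩ := hVne
  obtain ⟨ρ, hρ, hball⟩ := Metric.isOpen_iff.1 hV v hv
  obtain ⟨R, hR⟩ := hF.subset_closedBall v
  have hx : (0 : ℝ) < 3 / (a * ρ) := by positivity
  -- After rescaling by the ratio of `w`, the images of `v` lie within 2R + 1 of the origin (R for
  -- each of the two cylinders, 1 for the gap) and at mutual distance at least aρ. At x = 3 / (aρ)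
  -- the required separation 2 / x is strictly below aρ.
  refine ⟨boxCount (Metric.closedBall (0 : EuclideanSpace ℝ (Fin m)) (2 * R + 1))
    (3 / (a * ρ)), fun w S hS => ?_⟩
  have hw := Φ.wordRatio_pos w
  set f : List (Fin N) → EuclideanSpace ℝ (Fin m) :=
    fun s => (Φ.wordRatio w)⁻¹ • (Φ.wordMap s v - Φ.wordMap w v) with hf
  have hdist : ∀ s t, dist (f s) (f t) =
      (Φ.wordRatio w)⁻¹ * dist (Φ.wordMap s v) (Φ.wordMap t v) := by
    intro s t
    rw [hf, dist_smul₀, dist_sub_right, norm_inv, Real.norm_of_nonneg hw.le]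
  have hsep : ∀ s ∈ S, ∀ t ∈ S, s ≠ t → a * ρ ≤ dist (f s) (f t) := by
    intro s hs t ht hst
    rw [hdist]
    have hd := hS.disjoint s hs t ht hst
    have h1 : Φ.wordRatio s * ρ ≤ dist (Φ.wordMap s v) (Φ.wordMap t v) := by
      by_contra! hlt
      refine (Set.disjoint_left.1 hd ?_ : Φ.wordMap t v ∉ _) ⟨v, hv, rfl⟩
      refine image_mono hball (Φ.ball_subset_wordMap_image s v ρ ?_)
      rwa [Metric.mem_ball, dist_comm]
    rw [inv_mul_eq_div, le_div_iff₀ hw]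
    have := mul_le_mul_of_nonneg_right (hS.le_ratio s hs) hρ.le
    linarith
  have hinj : Set.InjOn f S := by
    intro s hs t ht hst
    by_contra hne
    have := hsep s hs t ht hne
    rw [hst, dist_self] at this
    exact absurd this (not_le.2 (by positivity))
  rw [← Finset.card_image_of_injOn hinj]
  refine le_boxCount Metric.isBounded_closedBall hx ?_ ((pairwiseDisjoint_closedBall_iff hx _).2 ?_)
  · rw [Finset.coe_image]
    rintro _ ⟨s, hs, rfl⟩
    obtain ⟨p, hp, q, hq, hpq⟩ := hS.close s hs
    rw [Metric.mem_closedBall, dist_zero_right, hf, norm_smul, norm_inv,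
      Real.norm_of_nonneg hw.le, ← dist_eq_norm, inv_mul_eq_div, div_le_iff₀ hw]
    have h1 : dist (Φ.wordMap s v) (Φ.wordMap s p) ≤ Φ.wordRatio w * R := by
      rw [Φ.dist_wordMap, dist_comm]
      exact mul_le_mul (hS.ratio_le s hs) (hR hp) dist_nonneg hw.le
    have h2 : dist (Φ.wordMap w q) (Φ.wordMap w v) ≤ Φ.wordRatio w * R := by
      rw [Φ.dist_wordMap]
      exact mul_le_mul_of_nonneg_left (hR hq) hw.le
    have := dist_triangle4 (Φ.wordMap s v) (Φ.wordMap s p) (Φ.wordMap w q) (Φ.wordMap w v)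
    linarith
  · rw [Finset.coe_image]
    rintro _ ⟨s, hs, rfl⟩ _ ⟨t, ht, rfl⟩ hst
    refine lt_of_lt_of_le ?_ (hsep s hs t ht fun h => hst (h ▸ rfl))
    have : 0 < a * ρ := by positivity
    rw [div_div_eq_mul_div]
    linarith

/-- Under the open set condition there is a word `w` such that, in every cylinder, the subcylinder
belonging to `w` is well separated from the first-level cylinders that do not contain it. -/
theorem OpenSetCondition.exists_separated_word {Φ : SelfSimilarSystem m N}
    (hΦ : Φ.OpenSetCondition) {F : Set (EuclideanSpace ℝ (Fin m))} (hF : Φ.IsAttractor F) :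
    ∃ w, ∃ ε : ℝ, 0 < ε ∧ ∀ (i j : Fin N), i ≠ j → ∀ (c : List (Fin N)), ∀ p ∈ F, ∀ q ∈ F,
      ε * Φ.wordRatio (i :: c) ≤ dist (Φ.wordMap (i :: c ++ w) p) (Φ.map j q) := by
  classical
  obtain ⟨V, hVne, hVo, hVsub, hVdisj⟩ := hΦ
  obtain ⟨a, _, ha0, _, _, ha⟩ := Φ.exists_ratio_bounds
  replace ha := fun j => (ha j).1
  obtain ⟨K, hK⟩ := Φ.exists_card_le_of_isNeighbourFamily hF.isCompact.isBounded hVo hVne ha0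
  have hbdd : BddAbove {k : ℕ | ∃ w S, Φ.IsNeighbourFamily F V a w S ∧ S.card = k} := by
    refine ⟨K, ?_⟩
    rintro k ⟨w, S, hS, rfl⟩
    exact hK w S hS
  have hne : {k : ℕ | ∃ w S, Φ.IsNeighbourFamily F V a w S ∧ S.card = k}.Nonempty :=
    ⟨0, [], ∅, ⟨by simp, by simp, by simp, by simp⟩, rfl⟩
  -- Choose `w` with a neighbour family `S` of the largest possible size. Prefixing any `v` carries
  -- `S` to a family for `v ++ w`, which is again of maximal size and admits no further member.
  obtain ⟨w, S, hS, hcard⟩ := Nat.sSup_mem hne hbdd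
  refine ⟨w, Φ.wordRatio w, Φ.wordRatio_pos w, ?_⟩
  intro i j hij c p hp q hq
  by_contra! hlt
  set v := i :: c with hv
  have hvpos := Φ.wordRatio_pos v
  have hδ := Φ.wordRatio_pos (v ++ w)
  -- Too close a point of piece `j` lies in a cylinder `j :: u` of size comparable to that of `v ++
  -- w`. Its first letter differs from that of `v`, so it would be an additional neighbour.
  obtain ⟨u, q', hq', rfl, hu1, hu2⟩ := hF.exists_word ha hδ (Φ.ratio_pos j)
    ((mul_le_of_le_one_right ha0.le (Φ.wordRatio_le_one _)).trans (ha j)) hq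
  have hnotin : j :: u ∉ S.image (v ++ ·) := by
    simp only [Finset.mem_image, hv, List.cons_append, List.cons.injEq, not_exists, not_and]
    intro s _ h
    exact absurd h hij
  have hdisj : ∀ s, Disjoint (Φ.wordMap (v ++ s) '' V) (Φ.wordMap (j :: u) '' V) := by
    intro s
    refine (hVdisj hij).mono ?_ ?_
    · rintro _ ⟨z, hz, rfl⟩
      exact ⟨_, Φ.wordMap_mapsTo hVsub (c ++ s) hz, rfl⟩
    · rintro _ ⟨z, hz, rfl⟩
      exact ⟨_, Φ.wordMap_mapsTo hVsub u hz, rfl⟩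
  have hfam : Φ.IsNeighbourFamily F V a (v ++ w) (insert (j :: u) (S.image (v ++ ·))) := by
    refine ⟨?_, ?_, ?_, ?_⟩
    · simp only [Finset.forall_mem_insert, Finset.forall_mem_image]
      refine ⟨by simpa using hu1, fun s hs => ?_⟩
      rw [wordRatio_append, wordRatio_append, mul_left_comm]
      exact mul_le_mul_of_nonneg_left (hS.le_ratio s hs) hvpos.le
    · simp only [Finset.forall_mem_insert, Finset.forall_mem_image]
      refine ⟨by simpa using hu2, fun s hs => ?_⟩
      rw [wordRatio_append, wordRatio_append]
      exact mul_le_mul_of_nonneg_left (hS.ratio_le s hs) hvpos.le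
    · simp only [Finset.forall_mem_insert, Finset.forall_mem_image]
      refine ⟨⟨q', hq', p, hp, ?_⟩, fun s hs => ?_⟩
      · rw [dist_comm, wordRatio_append, mul_comm]
        exact hlt.le
      · obtain ⟨p', hp', q'', hq'', h⟩ := hS.close s hs
        refine ⟨p', hp', q'', hq'', ?_⟩
        rw [wordMap_append, wordMap_append, Φ.dist_wordMap, wordRatio_append]
        exact mul_le_mul_of_nonneg_left h hvpos.le
    · simp only [Finset.forall_mem_insert, Finset.forall_mem_image]
      refine ⟨⟨fun h => absurd rfl h, fun s _ _ => (hdisj s).symm⟩,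
        fun s hs => ⟨fun _ => hdisj s, fun t ht hst => ?_⟩⟩
      have h := hS.disjoint s hs t ht fun h => hst (h ▸ rfl)
      have himg : ∀ l, Φ.wordMap (v ++ l) '' V = Φ.wordMap v '' (Φ.wordMap l '' V) := by
        intro l
        rw [image_image]
        exact image_congr fun z _ => Φ.wordMap_append v l z
      rw [himg, himg]
      exact (disjoint_image_iff (Φ.wordMap_injective v)).2 h
  have h1 : (insert (j :: u) (S.image (v ++ ·))).card = S.card + 1 := by
    rw [Finset.card_insert_of_notMem hnotin,
      Finset.card_image_of_injective _ (List.append_right_injective v)]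
  have h2 := le_csSup hbdd ⟨_, _, hfam, rfl⟩
  rw [h1, hcard] at h2
  omega

/-- Under the open set condition the attractor is infinite. -/
theorem OpenSetCondition.infinite {Φ : SelfSimilarSystem m N} (hΦ : Φ.OpenSetCondition)
    {F : Set (EuclideanSpace ℝ (Fin m))} (hF : Φ.IsAttractor F) : F.Infinite := by
  intro hfin
  obtain ⟨w, ε, hε, hsep⟩ := hΦ.exists_separated_word hF
  have hN := Φ.two_le
  obtain ⟨q, hq⟩ := hF.nonempty
  let i : Fin N := ⟨0, by omega⟩
  let j : Fin N := ⟨1, by omega⟩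
  have hij : i ≠ j := by simp [i, j]
  -- An injective self-map of a finite set is onto, so a point of piece `j` would lie in the
  -- cylinder of `[i] ++ w`, at distance zero from piece `j`.
  have hsurj : SurjOn (Φ.wordMap ([i] ++ w)) F F :=
    (Set.Finite.surjOn_iff_bijOn_of_mapsTo hfin (hF.mapsTo _)).2
      ((Set.Finite.injOn_iff_bijOn_of_mapsTo hfin (hF.mapsTo _)).1 (Φ.wordMap_injective _).injOn)
  obtain ⟨p, hp, hpq⟩ := hsurj (hF.mapsTo [j] hq)
  have := hsep i j hij [] p hp q hq
  rw [hpq] at this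
  simp only [wordMap_cons, wordMap_nil, dist_self] at this
  exact absurd this (not_le.2 (mul_pos hε (Φ.wordRatio_pos _)))

end SelfSimilarSystem

/-! ### Renewal inequalities -/

section Renewal

variable {ι : Type*} {ρ : ι → ℝ}

/-- The index type may be empty, which occurs when the separated word is empty, so the bounds cannot
be taken as extremal ratios. -/
theorem exists_bounds_mem_Ioo_zero_one [Finite ι] (h0 : ∀ i, 0 < ρ i) (h1 : ∀ i, ρ i < 1) :
    ∃ a b : ℝ, 0 < a ∧ a < 1 ∧ 0 < b ∧ b < 1 ∧ ∀ i, a ≤ ρ i ∧ ρ i ≤ b := by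
  have ha : ∀ᶠ a : ℝ in 𝓝[>] 0, (∀ i, a < ρ i) ∧ a < 1 ∧ a ∈ Ioi (0 : ℝ) :=
    (eventually_all.2 fun i => nhdsWithin_le_nhds (gt_mem_nhds (h0 i))).and
      ((eventually_nhdsWithin_of_eventually_nhds (gt_mem_nhds one_pos)).and self_mem_nhdsWithin)
  have hb : ∀ᶠ b : ℝ in 𝓝[<] 1, (∀ i, ρ i < b) ∧ 0 < b ∧ b ∈ Iio (1 : ℝ) :=
    (eventually_all.2 fun i => nhdsWithin_le_nhds (lt_mem_nhds (h1 i))).and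
      ((eventually_nhdsWithin_of_eventually_nhds (lt_mem_nhds one_pos)).and self_mem_nhdsWithin)
  obtain ⟨a, ha, ha1, ha0⟩ := ha.exists
  obtain ⟨b, hb, hb0, hb1⟩ := hb.exists
  exact ⟨a, b, ha0, ha1, hb0, hb1, fun i => ⟨(ha i).le, (hb i).le⟩⟩

theorem exists_mul_pow_lt {b : ℝ} (hb1 : b < 1) {x y : ℝ} (hx : 0 < x)
    (hy : 0 < y) : ∃ k : ℕ, x * b ^ k < y := by
  obtain ⟨k, hk⟩ := exists_pow_lt_of_lt_one (div_pos hy hx) hb1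
  exact ⟨k, by rw [lt_div_iff₀ hx] at hk; linarith⟩

/-- Upper bound in a renewal inequality, for a family of sets of values. -/
theorem exists_le_rpow_of_renewal [Fintype ι] (h0 : ∀ i, 0 < ρ i) (h1 : ∀ i, ρ i < 1) {s : ℝ}
    (hs : 0 ≤ s) (hsum : ∑ i, ρ i ^ s ≤ 1) {𝒜 : ℝ → Set ℝ} {x₀ K₀ : ℝ} (hx₀ : 0 < x₀)
    (hbase : ∀ x, 0 < x → x < x₀ → ∀ v ∈ 𝒜 x, v ≤ K₀)
    (hstep : ∀ x, x₀ ≤ x → ∀ v ∈ 𝒜 x, ∃ u : ι → ℝ, (∀ i, u i ∈ 𝒜 (ρ i * x)) ∧ v ≤ ∑ i, u i) :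
    ∃ K, 0 ≤ K ∧ ∀ x, x₀ ≤ x → ∀ v ∈ 𝒜 x, v ≤ K * x ^ s := by
  obtain ⟨a, b, ha0, ha1, hb0, hb1, hab⟩ := exists_bounds_mem_Ioo_zero_one h0 h1
  have hx₁ : 0 < a * x₀ := mul_pos ha0 hx₀
  have hx₁' : a * x₀ ≤ x₀ := mul_le_of_le_one_left hx₀.le ha1.le
  set K := max K₀ 0 / (a * x₀) ^ s with hK
  have hpow : 0 < (a * x₀) ^ s := Real.rpow_pos_of_pos hx₁ s
  have hK0 : 0 ≤ K := div_nonneg (le_max_right _ _) hpow.le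
  -- For x ≥ x₀ the arguments `ρ i * x` can fall below x₀ but not below a x₀, so the induction
  -- starts there, and K is chosen to cover K₀ on that base interval. The exponent k bounds the
  -- number of contractions needed.
  have key : ∀ k : ℕ, ∀ x, a * x₀ ≤ x → x * b ^ k < x₀ → ∀ v ∈ 𝒜 x, v ≤ K * x ^ s := by
    intro k
    have hb : ∀ x, a * x₀ ≤ x → x < x₀ → ∀ v ∈ 𝒜 x, v ≤ K * x ^ s := by
      intro x hx hx' v hv
      refine (hbase x (hx₁.trans_le hx) hx' v hv).trans ((le_max_left _ 0).trans ?_)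
      calc max K₀ 0 = K * (a * x₀) ^ s := by rw [hK, div_mul_cancel₀ _ hpow.ne']
        _ ≤ K * x ^ s := by gcongr
    induction k with
    | zero => exact fun x hx hx' => hb x hx (by simpa using hx')
    | succ k ih =>
      intro x hx hxk v hv
      by_cases hxx : x < x₀
      · exact hb x hx hxx v hv
      rw [not_lt] at hxx
      have hxpos : 0 < x := hx₀.trans_le hxx
      obtain ⟨u, hu, hvu⟩ := hstep x hxx v hv
      have hui : ∀ i, u i ≤ K * (ρ i ^ s * x ^ s) := by
        intro i
        rw [← Real.mul_rpow (h0 i).le hxpos.le]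
        refine ih _ ?_ ?_ _ (hu i)
        · exact mul_le_mul (hab i).1 hxx hx₀.le (h0 i).le
        · refine lt_of_le_of_lt ?_ hxk
          calc ρ i * x * b ^ k ≤ b * x * b ^ k := by gcongr; exact (hab i).2
            _ = x * b ^ (k + 1) := by ring
      calc v ≤ ∑ i, K * (ρ i ^ s * x ^ s) := hvu.trans (Finset.sum_le_sum fun i _ => hui i)
        _ = K * x ^ s * ∑ i, ρ i ^ s := by
          rw [Finset.mul_sum]; exact Finset.sum_congr rfl fun i _ => by ring
        _ ≤ K * x ^ s := mul_le_of_le_one_right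
          (mul_nonneg hK0 (Real.rpow_nonneg hxpos.le s)) hsum
  refine ⟨K, hK0, fun x hx => ?_⟩
  obtain ⟨k, hk⟩ := exists_mul_pow_lt hb1 (hx₀.trans_le hx) hx₀
  exact key k x (hx₁'.trans hx) hk

/-- Lower bound in a renewal inequality. -/
theorem exists_rpow_le_of_renewal [Fintype ι] (h0 : ∀ i, 0 < ρ i) (h1 : ∀ i, ρ i < 1) {s : ℝ}
    (hs : 0 ≤ s) (hsum : 1 ≤ ∑ i, ρ i ^ s) {f : ℝ → ℝ} {x₀ : ℝ} (hx₀ : 0 < x₀)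
    (hbase : ∀ x, 0 < x → 1 ≤ f x)
    (hstep : ∀ x, x₀ ≤ x → ∑ i, f (ρ i * x) ≤ f x) :
    ∃ c, 0 < c ∧ ∀ x, 0 < x → c * x ^ s ≤ f x := by
  obtain ⟨a, b, -, -, hb0, hb1, hab⟩ := exists_bounds_mem_Ioo_zero_one h0 h1
  have hpow : 0 < x₀ ^ s := Real.rpow_pos_of_pos hx₀ s
  refine ⟨(x₀ ^ s)⁻¹, inv_pos.2 hpow, ?_⟩
  have key : ∀ k : ℕ, ∀ x, 0 < x → x * b ^ k < x₀ → (x₀ ^ s)⁻¹ * x ^ s ≤ f x := by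
    have hb : ∀ x, 0 < x → x < x₀ → (x₀ ^ s)⁻¹ * x ^ s ≤ f x := by
      intro x hx hx'
      refine le_trans ?_ (hbase x hx)
      rw [inv_mul_le_iff₀ hpow, mul_one]
      exact Real.rpow_le_rpow hx.le hx'.le hs
    intro k
    induction k with
    | zero => exact fun x hx hx' => hb x hx (by simpa using hx')
    | succ k ih =>
      intro x hx hxk
      by_cases hxx : x < x₀
      · exact hb x hx hxx
      refine le_trans ?_ (hstep x (not_lt.1 hxx))
      have hui : ∀ i, (x₀ ^ s)⁻¹ * (ρ i ^ s * x ^ s) ≤ f (ρ i * x) := by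
        intro i
        rw [← Real.mul_rpow (h0 i).le hx.le]
        refine ih _ (mul_pos (h0 i) hx) (lt_of_le_of_lt ?_ hxk)
        calc ρ i * x * b ^ k ≤ b * x * b ^ k := by gcongr; exact (hab i).2
          _ = x * b ^ (k + 1) := by ring
      calc (x₀ ^ s)⁻¹ * x ^ s ≤ (x₀ ^ s)⁻¹ * x ^ s * ∑ i, ρ i ^ s :=
            le_mul_of_one_le_right
              (mul_nonneg (inv_pos.2 hpow).le (Real.rpow_nonneg hx.le s)) hsum
        _ = ∑ i, (x₀ ^ s)⁻¹ * (ρ i ^ s * x ^ s) := by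
          rw [Finset.mul_sum]; exact Finset.sum_congr rfl fun i _ => by ring
        _ ≤ ∑ i, f (ρ i * x) := Finset.sum_le_sum fun i _ => hui i
  intro x hx
  obtain ⟨k, hk⟩ := exists_mul_pow_lt hb1 hx hx₀
  exact key k x hx hk

end Renewal

theorem boxCount_empty {m : ℕ} {x : ℝ} (hx : 0 < x) :
    boxCount (∅ : Set (EuclideanSpace ℝ (Fin m))) x = 0 := by
  obtain ⟨t, ht, -, hc⟩ := exists_boxCount (m := m) Bornology.isBounded_empty hx
  rw [← hc, Finset.card_eq_zero, ← Finset.coe_eq_empty]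
  exact subset_empty_iff.1 ht

namespace SelfSimilarSystem

variable {m N : ℕ} (Φ : SelfSimilarSystem m N)

/-! ### The Moran equation -/

theorem continuous_sum_ratio_rpow : Continuous fun s : ℝ => ∑ j, Φ.ratio j ^ s :=
  continuous_finsetSum _ fun j _ => Real.continuous_const_rpow (Φ.ratio_pos j).ne'

theorem strictAnti_sum_ratio_rpow : StrictAnti fun s : ℝ => ∑ j, Φ.ratio j ^ s := by
  have hN := Φ.two_le
  intro s t hst
  refine Finset.sum_lt_sum_of_nonempty ⟨⟨0, by omega⟩, Finset.mem_univ _⟩ fun j _ => ?_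
  exact Real.rpow_lt_rpow_of_exponent_gt (Φ.ratio_pos j) (Φ.ratio_lt_one j) hst

theorem exists_isSimilarityDimension : ∃ D : ℝ, 0 < D ∧ ∑ j, Φ.ratio j ^ D = 1 := by
  have hN : (2 : ℝ) ≤ N := by exact_mod_cast Φ.two_le
  have h0 : ∑ j, Φ.ratio j ^ (0 : ℝ) = N := by simp
  have hlim : Tendsto (fun s : ℝ => ∑ j, Φ.ratio j ^ s) atTop (𝓝 (∑ _j : Fin N, (0 : ℝ))) :=
    tendsto_finsetSum _ fun j _ => tendsto_rpow_atTop_of_base_lt_one _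
      (by linarith [Φ.ratio_pos j]) (Φ.ratio_lt_one j)
  rw [Finset.sum_const_zero] at hlim
  obtain ⟨t, ht, ht0⟩ :=
    ((hlim.eventually (gt_mem_nhds one_pos)).and (eventually_ge_atTop 0)).exists
  obtain ⟨D, hD, hD1⟩ := intermediate_value_Icc' ht0 Φ.continuous_sum_ratio_rpow.continuousOn
    (show (1 : ℝ) ∈ _ from ⟨ht.le, by rw [h0]; linarith⟩)
  refine ⟨D, lt_of_le_of_ne hD.1 ?_, hD1⟩
  rintro rfl
  simp only [h0] at hD1
  linarith

/-! ### Words of a fixed length -/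

theorem wordRatio_lt_one {w : List (Fin N)} (hw : w ≠ []) : Φ.wordRatio w < 1 := by
  cases w with
  | nil => exact absurd rfl hw
  | cons j w =>
    rw [wordRatio_cons]
    exact (mul_le_of_le_one_right (Φ.ratio_pos j).le (Φ.wordRatio_le_one w)).trans_lt
      (Φ.ratio_lt_one j)

theorem sum_wordRatio_ofFn_rpow (n : ℕ) (s : ℝ) :
    ∑ b : Fin n → Fin N, Φ.wordRatio (List.ofFn b) ^ s = (∑ j, Φ.ratio j ^ s) ^ n := by
  rw [Fintype.sum_pow]
  refine Finset.sum_congr rfl fun b _ => ?_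
  rw [wordRatio, List.map_ofFn, List.prod_ofFn,
    Real.finsetProd_rpow _ _ fun i _ => (Φ.ratio_pos _).le]
  rfl

theorem IsAttractor.exists_ofFn {Φ : SelfSimilarSystem m N}
    {F : Set (EuclideanSpace ℝ (Fin m))} (hF : Φ.IsAttractor F) (n : ℕ)
    {p : EuclideanSpace ℝ (Fin m)} (hp : p ∈ F) :
    ∃ b : Fin n → Fin N, ∃ q ∈ F, Φ.wordMap (List.ofFn b) q = p := by
  induction n generalizing p with
  | zero => exact ⟨Fin.elim0, p, hp, rfl⟩
  | succ n ih =>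
    obtain ⟨j, q, hq, rfl⟩ := hF.exists_map_eq hp
    obtain ⟨b, q', hq', rfl⟩ := ih hq
    exact ⟨Fin.cons j b, q', hq', by simp⟩

/-! ### Growth of the box-counting function of the attractor -/

variable {Φ} {F : Set (EuclideanSpace ℝ (Fin m))}

theorem IsAttractor.boxCount_wordMap_image (hF : Φ.IsAttractor F)
    {A : Set (EuclideanSpace ℝ (Fin m))} (hA : A ⊆ F) (w : List (Fin N)) {x : ℝ} (hx : 0 < x) :
    boxCount (Φ.wordMap w '' A) x = boxCount A (Φ.wordRatio w * x) :=
  boxCount_image (Φ.wordRatio_pos w) (Φ.dist_wordMap w) (hF.isCompact.isBounded.subset hA) hx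

theorem IsAttractor.boxCount_map_image (hF : Φ.IsAttractor F)
    {A : Set (EuclideanSpace ℝ (Fin m))} (hA : A ⊆ F) (j : Fin N) {x : ℝ} (hx : 0 < x) :
    boxCount (Φ.map j '' A) x = boxCount A (Φ.ratio j * x) :=
  boxCount_image (Φ.ratio_pos j) (Φ.dist_map j) (hF.isCompact.isBounded.subset hA) hx

theorem IsAttractor.boxCount_le_sum_ratio (hF : Φ.IsAttractor F) {x : ℝ} (hx : 0 < x) :
    boxCount F x ≤ ∑ j, boxCount F (Φ.ratio j * x) := by
  have h := boxCount_le_sum (A := F) (B := fun j => Φ.map j '' F)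
    (fun j => hF.isCompact.isBounded.subset (hF.image_subset j)) hF.iUnion_image.ge hx
  simpa only [hF.boxCount_map_image subset_rfl _ hx] using h

/-- Since ∑ r_j ^ D = 1, multiples of x ^ D solve the renewal equation exactly and so dominate its
subsolution N. -/
theorem IsAttractor.exists_boxCount_le_rpow (hF : Φ.IsAttractor F) {D : ℝ} (hD0 : 0 ≤ D)
    (hD : ∑ j, Φ.ratio j ^ D = 1) :
    ∃ K, 0 ≤ K ∧ ∀ x, 1 ≤ x → (boxCount F x : ℝ) ≤ K * x ^ D := by
  obtain ⟨K, hK, h⟩ := exists_le_rpow_of_renewal Φ.ratio_pos Φ.ratio_lt_one hD0 hD.le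
    (𝒜 := fun x => {(boxCount F x : ℝ)}) (x₀ := 1) (K₀ := boxCount F 1) one_pos
    (by
      rintro x hx hx1 _ rfl
      exact_mod_cast boxCount_mono hF.isCompact.isBounded hx hx1.le)
    (by
      rintro x hx _ rfl
      exact ⟨fun j => boxCount F (Φ.ratio j * x), fun j => rfl,
        by beta_reduce; exact_mod_cast hF.boxCount_le_sum_ratio (one_pos.trans_le hx)⟩)
  exact ⟨K, hK, fun x hx => h x hx _ rfl⟩

/-- Subsets of the attractor that avoid every cylinder whose word ends in a fixed word, up to the
scale `x`, have box-counting functions of a smaller order of growth. -/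
theorem IsAttractor.exists_boxCount_le_of_avoids (hF : Φ.IsAttractor F) {D : ℝ} (hD0 : 0 < D)
    (hD : ∑ j, Φ.ratio j ^ D = 1) (w : List (Fin N)) {C : ℝ} (hC : 0 < C) :
    ∃ s K, 0 < s ∧ s < D ∧ 0 ≤ K ∧ ∀ x, C ≤ x → ∀ A ⊆ F,
      (∀ c, C ≤ Φ.wordRatio c * x → ∀ p ∈ F, Φ.wordMap (c ++ w) p ∉ A) →
      (boxCount A x : ℝ) ≤ K * x ^ s := by
  classical
  set n := w.length
  set β : Fin n → Fin N := w.get with hβ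
  have hw : List.ofFn β = w := List.ofFn_get w
  set ρ : {b : Fin n → Fin N // b ≠ β} → ℝ := fun b => Φ.wordRatio (List.ofFn b.1) with hρ
  have hρ0 : ∀ b, 0 < ρ b := fun b => Φ.wordRatio_pos _
  have hρ1 : ∀ b, ρ b < 1 := by
    intro b
    -- If `w` is empty there is no word other than β, and the index type is empty.
    refine Φ.wordRatio_lt_one fun h => b.2 ?_
    have hn : n = 0 := by simpa using congrArg List.length h
    ext i
    exact absurd i.2 (by omega)
  have hcont : Continuous fun s : ℝ => ∑ b, ρ b ^ s :=
    continuous_finsetSum _ fun b _ => Real.continuous_const_rpow (hρ0 b).ne'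
  -- All words of length n have total weight 1 at D. Omitting β makes this strictly less than 1, and
  -- continuity leaves room for an exponent s < D.
  have hlt : ∑ b, ρ b ^ D < 1 := by
    have h := Φ.sum_wordRatio_ofFn_rpow n D
    rw [hD, one_pow, Fintype.sum_eq_add_sum_subtype_ne _ β] at h
    have := Real.rpow_pos_of_pos (Φ.wordRatio_pos (List.ofFn β)) D
    simp only [hρ]
    linarith
  have hev : ∀ᶠ s in 𝓝[<] D, ∑ b, ρ b ^ s < 1 ∧ 0 < s ∧ s ∈ Iio D :=
    (eventually_nhdsWithin_of_eventually_nhds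
      (hcont.continuousAt.eventually (gt_mem_nhds hlt))).and
      ((eventually_nhdsWithin_of_eventually_nhds (lt_mem_nhds hD0)).and self_mem_nhdsWithin)
  obtain ⟨s, hs, hs0, hsD⟩ := hev.exists
  obtain ⟨K, hK, h⟩ := exists_le_rpow_of_renewal hρ0 hρ1 hs0.le hs.le
    (𝒜 := fun x => {v : ℝ | ∃ A ⊆ F,
      (∀ c, C ≤ Φ.wordRatio c * x → ∀ p ∈ F, Φ.wordMap (c ++ w) p ∉ A) ∧ v = boxCount A x})
    (x₀ := C) (K₀ := boxCount F C) hC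
    (by
      rintro x hx hxC _ ⟨A, hA, -, rfl⟩
      exact_mod_cast (boxCount_mono_set hF.isCompact.isBounded hA hx).trans
        (boxCount_mono hF.isCompact.isBounded hx hxC.le))
    (by
      rintro x hx _ ⟨A, hA, hav, rfl⟩
      have hx0 : 0 < x := hC.trans_le hx
      -- The pullback of `A` to each cylinder again avoids the forbidden cylinders, now at scale `ρ
      -- b * x`. The sets change at every step, so the renewal bound must treat all avoiding subsets
      -- at once.
      set A' : {b : Fin n → Fin N // b ≠ β} → Set (EuclideanSpace ℝ (Fin m)) :=
        fun b => {q ∈ F | Φ.wordMap (List.ofFn b.1) q ∈ A} with hA'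
      have hA'F : ∀ b, A' b ⊆ F := fun b => sep_subset _ _
      refine ⟨fun b => boxCount (A' b) (ρ b * x), fun b => ⟨A' b, hA'F b, ?_, rfl⟩, ?_⟩
      · intro c hc p hp hpA
        refine hav (List.ofFn b.1 ++ c) ?_ p hp ?_
        · rw [wordRatio_append, mul_right_comm, mul_comm]
          simpa only [hρ, mul_assoc, mul_comm, mul_left_comm] using hc
        · rw [List.append_assoc, wordMap_append]
          exact hpA.2
      · have hcov : A ⊆ ⋃ b, Φ.wordMap (List.ofFn b.1) '' A' b := by
          intro p hp
          obtain ⟨b, q, hq, rfl⟩ := hF.exists_ofFn n (hA hp)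
          have hb : b ≠ β := by
            rintro rfl
            refine hav [] (by simpa using hx) q hq ?_
            rwa [List.nil_append, ← hw]
          exact mem_iUnion.2 ⟨⟨b, hb⟩, q, ⟨hq, hp⟩, rfl⟩
        have hle := boxCount_le_sum (fun b => hF.isCompact.isBounded.subset
          ((image_mono (hA'F b)).trans (hF.mapsTo (List.ofFn b.1)).image_subset)) hcov hx0
        simp only [hF.boxCount_wordMap_image (hA'F _) _ hx0] at hle
        beta_reduce
        exact_mod_cast hle)
  exact ⟨s, K, hs0, hsD, hK, fun x hx A hA hav => h x hx _ ⟨A, hA, hav, rfl⟩⟩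

/-- Under the open set condition the error in the renewal equation of the box-counting function has
a smaller order of growth. -/
theorem OpenSetCondition.exists_sum_boxCount_sub_le (hΦ : Φ.OpenSetCondition)
    (hF : Φ.IsAttractor F) {D : ℝ} (hD0 : 0 < D) (hD : ∑ j, Φ.ratio j ^ D = 1) :
    ∃ s K x₀, 0 < s ∧ s < D ∧ 0 < x₀ ∧ ∀ x, x₀ ≤ x →
      |∑ j, (boxCount F (Φ.ratio j * x) : ℝ) - boxCount F x| ≤ K * x ^ s := by
  obtain ⟨w, ε, hε, hsep⟩ := hΦ.exists_separated_word hF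
  obtain ⟨a, _, ha0, _, _, ha⟩ := Φ.exists_ratio_bounds
  obtain ⟨s, K, hs0, hsD, hK, h⟩ := hF.exists_boxCount_le_of_avoids hD0 hD w
    (C := 3 / ε) (by positivity)
  -- One error term per letter gives the factor N; the threshold guarantees `Φ.ratio i * x ≥ 3 / ε`.
  refine ⟨s, N * K, 3 / ε / a, hs0, hsD, by positivity, fun x hx => ?_⟩
  have hx0 : 0 < x := lt_of_lt_of_le (by positivity) hx
  have hsub : (boxCount F x : ℝ) ≤ ∑ j, (boxCount F (Φ.ratio j * x) : ℝ) := by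
    exact_mod_cast hF.boxCount_le_sum_ratio hx0
  rw [abs_of_nonneg (sub_nonneg.2 hsub), sub_le_iff_le_add']
  have hsuper := sum_boxCount_le hF.isCompact.isBounded hF.image_subset hx0
  simp only [hF.boxCount_map_image subset_rfl _ hx0] at hsuper
  have hbad : ∀ i, (boxCount {p ∈ Φ.map i '' F | ∃ j, j ≠ i ∧ ∃ q ∈ Φ.map j '' F,
      dist p q ≤ 2 / x} x : ℝ) ≤ K * x ^ s := by
    intro i
    set A := {p ∈ F | ∃ j, j ≠ i ∧ ∃ q ∈ Φ.map j '' F, dist (Φ.map i p) q ≤ 2 / x} with hA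
    have hAF : A ⊆ F := sep_subset _ _
    have himg : {p ∈ Φ.map i '' F | ∃ j, j ≠ i ∧ ∃ q ∈ Φ.map j '' F, dist p q ≤ 2 / x} =
        Φ.map i '' A := by
      ext p
      constructor
      · rintro ⟨⟨p, hp, rfl⟩, hq⟩
        exact ⟨p, ⟨hp, hq⟩, rfl⟩
      · rintro ⟨p, ⟨hp, hq⟩, rfl⟩
        exact ⟨⟨p, hp, rfl⟩, hq⟩
    have hri := Φ.ratio_pos i
    rw [himg, hF.boxCount_map_image hAF i hx0]
    have hCx : 3 / ε ≤ Φ.ratio i * x := by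
      rw [div_le_iff₀ ha0] at hx
      nlinarith [(ha i).1]
    refine (h _ hCx A hAF ?_).trans ?_
    · rintro c hc p hp ⟨-, j, hji, _, ⟨q, hq, rfl⟩, hpq⟩
      have h1 := (hsep i j hji.symm c p hp q hq).trans hpq
      rw [wordRatio_cons, le_div_iff₀ hx0] at h1
      rw [div_le_iff₀ hε] at hc
      nlinarith
    · gcongr
      exact mul_le_of_le_one_left hx0.le (Φ.ratio_lt_one i).le
  calc ∑ j, (boxCount F (Φ.ratio j * x) : ℝ)
      ≤ boxCount F x + ∑ i, (boxCount {p ∈ Φ.map i '' F | ∃ j, j ≠ i ∧ ∃ q ∈ Φ.map j '' F,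
        dist p q ≤ 2 / x} x : ℝ) := by exact_mod_cast hsuper
    _ ≤ boxCount F x + ∑ _i : Fin N, K * x ^ s := by
      gcongr with i
      exact hbad i
    _ = boxCount F x + N * K * x ^ s := by simp [mul_assoc]

/-- Under the open set condition the box-counting function grows at least like `x ^ s` for every
`s` less than the similarity dimension. -/
theorem OpenSetCondition.exists_rpow_le_boxCount (hΦ : Φ.OpenSetCondition)
    (hF : Φ.IsAttractor F) {s : ℝ} (hs : 0 ≤ s) (hsum : 1 < ∑ j, Φ.ratio j ^ s) :
    ∃ c, 0 < c ∧ ∀ x, 0 < x → c * x ^ s ≤ boxCount F x := by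
  obtain ⟨w, ε, hε, hsep⟩ := hΦ.exists_separated_word hF
  have hws : 0 < Φ.wordRatio w ^ s := Real.rpow_pos_of_pos (Φ.wordRatio_pos w) s
  -- The suffix `w` costs the factor `Φ.wordRatio w ^ s` in the Moran sum; enough leading letters
  -- compensate for it. Requiring n ≥ 1 keeps the words nonempty even if `w` is empty.
  obtain ⟨n, hn, hn1⟩ := (((tendsto_pow_atTop_atTop_of_one_lt hsum).eventually_ge_atTop
    (Φ.wordRatio w ^ s)⁻¹).and (eventually_ge_atTop 1)).exists
  -- Strip the common prefix; at the first differing letter the separated word applies.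
  have hdist : ∀ l l' : List (Fin N), l.length = l'.length → l ≠ l' → ∃ δ : ℝ, 0 < δ ∧
      ∀ p ∈ F, ∀ q ∈ F, δ ≤ dist (Φ.wordMap (l ++ w) p) (Φ.wordMap (l' ++ w) q) := by
    intro l
    induction l with
    | nil =>
      intro l' hl hne
      exact absurd (List.length_eq_zero_iff.1 hl.symm).symm hne
    | cons i l ih =>
      rintro (_ | ⟨j, l'⟩) hl hne
      · simp at hl
      by_cases hij : i = j
      · subst hij
        obtain ⟨δ, hδ, h⟩ := ih l' (by simpa using hl) (by simpa using hne)
        refine ⟨Φ.ratio i * δ, mul_pos (Φ.ratio_pos i) hδ, fun p hp q hq => ?_⟩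
        rw [List.cons_append, List.cons_append, wordMap_cons, wordMap_cons, Φ.dist_map]
        exact mul_le_mul_of_nonneg_left (h p hp q hq) (Φ.ratio_pos i).le
      · exact ⟨ε * Φ.wordRatio (i :: l), mul_pos hε (Φ.wordRatio_pos _), fun p hp q hq =>
          hsep i j hij l p hp _ (hF.mapsTo (l' ++ w) hq)⟩
  have hev : ∀ᶠ δ : ℝ in 𝓝[>] 0, (∀ b b' : Fin n → Fin N, b ≠ b' → ∀ p ∈ F, ∀ q ∈ F,
      δ < dist (Φ.wordMap (List.ofFn b ++ w) p) (Φ.wordMap (List.ofFn b' ++ w) q)) ∧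
      δ ∈ Ioi (0 : ℝ) := by
    refine Filter.Eventually.and ?_ self_mem_nhdsWithin
    refine eventually_all.2 fun b => eventually_all.2 fun b' => ?_
    by_cases hb : b = b'
    · exact Eventually.of_forall fun δ h => absurd hb h
    · obtain ⟨δ, hδ, h⟩ := hdist (List.ofFn b) (List.ofFn b') (by simp)
        fun h => hb (List.ofFn_injective h)
      filter_upwards [nhdsWithin_le_nhds (gt_mem_nhds hδ)] with δ' hδ' _ p hp q hq
      exact lt_of_lt_of_le hδ' (h p hp q hq)
  obtain ⟨δ, hδ, hδ0 : 0 < δ⟩ := hev.exists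
  refine exists_rpow_le_of_renewal (ρ := fun b : Fin n → Fin N => Φ.wordRatio (List.ofFn b ++ w))
    (fun b => Φ.wordRatio_pos _) (fun b => Φ.wordRatio_lt_one fun h => ?_) hs ?_
    (f := fun x => boxCount F x) (x₀ := 2 / δ) (by positivity)
    (fun x hx => by exact_mod_cast one_le_boxCount hF.isCompact.isBounded hF.nonempty hx)
    (fun x hx => ?_)
  · have := congrArg List.length h
    simp only [List.length_append, List.length_ofFn, List.length_nil] at this
    omega
  · simp only [wordRatio_append, Real.mul_rpow (Φ.wordRatio_pos _).le (Φ.wordRatio_pos _).le]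
    rw [← Finset.sum_mul, Φ.sum_wordRatio_ofFn_rpow, ← inv_le_iff_one_le_mul₀ hws]
    exact hn
  · have hx0 : 0 < x := lt_of_lt_of_le (by positivity) hx
    have hsuper := sum_boxCount_le hF.isCompact.isBounded
      (B := fun b : Fin n → Fin N => Φ.wordMap (List.ofFn b ++ w) '' F)
      (fun b => (hF.mapsTo _).image_subset) hx0
    -- Once 2 / x ≤ δ no two of these cylinders interact, so superadditivity holds without error.
    have hempty : ∀ b : Fin n → Fin N, {p ∈ Φ.wordMap (List.ofFn b ++ w) '' F | ∃ b', b' ≠ b ∧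
        ∃ q ∈ Φ.wordMap (List.ofFn b' ++ w) '' F, dist p q ≤ 2 / x} = ∅ := by
      intro b
      refine eq_empty_of_forall_notMem ?_
      rintro _ ⟨⟨p, hp, rfl⟩, b', hb', _, ⟨q, hq, rfl⟩, hpq⟩
      have h1 := hδ b b' hb'.symm p hp q hq
      rw [div_le_iff₀ hδ0] at hx
      rw [le_div_iff₀ hx0] at hpq
      nlinarith
    simp only [hempty, boxCount_empty hx0, Finset.sum_const_zero, add_zero,
      hF.boxCount_wordMap_image subset_rfl _ hx0] at hsuper
    exact_mod_cast hsuper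

end SelfSimilarSystem

/-! ### The zeta function of a box-counting string as a Mellin transform -/

section BoxCountingString

open MeasureTheory

variable {m : ℕ} {A : Set (EuclideanSpace ℝ (Fin m))}

/-- Left-continuity: a larger value at x would already be attained at some z < x, and the jump could
not lie beyond z. -/
theorem boxCount_le_value (hA : Bornology.IsBounded A) (hi : A.Infinite) {n : ℕ} {x : ℝ}
    (hx : 0 < x) (h : x ≤ boxCountJump A n) : boxCount A x ≤ boxCountValue A n := by
  by_contra! hlt
  obtain ⟨z, hz, hzx, hle⟩ := exists_lt_boxCount_eq hA hx
  refine absurd (h.trans (csSup_le (exists_boxCount_eq_value hA hi n) fun w hw => ?_))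
    (not_le.2 hzx)
  refine (lt_of_boxCount_lt hA hz ?_).le
  rw [hw.2]
  exact hlt.trans_le hle

theorem value_succ_le_boxCount (hA : Bornology.IsBounded A) (hi : A.Infinite) {n : ℕ} {x : ℝ}
    (h : boxCountJump A n < x) : boxCountValue A (n + 1) ≤ boxCount A x := by
  have hx : 0 < x := (boxCountJump_pos hA hi n).trans h
  obtain ⟨w, hw, hwn⟩ := exists_boxCount_eq_value hA hi n
  have h1 : boxCountValue A n ≤ boxCount A x :=
    hwn ▸ boxCount_mono hA hw ((le_boxCountJump hA hi hw hwn).trans h.le)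
  have h2 : boxCountValue A n ≠ boxCount A x :=
    fun heq => absurd (le_boxCountJump hA hi hx heq.symm) (not_le.2 h)
  obtain ⟨k, hk⟩ : ∃ k, boxCountValue A k = boxCount A x := by
    have hrange := Nat.range_nth_of_infinite (p := (· ∈ boxCountRange A))
      (boxCountRange_infinite hA hi)
    exact (Set.ext_iff.1 hrange (boxCount A x)).2 ⟨x, hx, rfl⟩
  have hmono := boxCountValue_strictMono hA hi
  rw [← hk] at h1 h2 ⊢
  exact hmono.monotone (hmono.lt_iff_lt.1 (lt_of_le_of_ne h1 h2))

/-- The sum telescopes because the first multiplicity is the second value itself, not a difference.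
-/
theorem sum_mult_boxCountingString (hA : Bornology.IsBounded A) (hi : A.Infinite) (k : ℕ) :
    ∑ n ∈ Finset.range (k + 1), (boxCountingString A hA hi).mult n = boxCountValue A (k + 1) := by
  induction k with
  | zero => simp [boxCountingString]
  | succ k ih =>
    have := boxCountValue_strictMono hA hi (Nat.lt_succ_self (k + 1))
    rw [Finset.sum_range_succ, ih]
    simp only [boxCountingString, Nat.succ_ne_zero, if_false]
    simp only [Nat.succ_eq_add_one] at this
    omega

/-- The box-counting function, cut off at the first jump. -/
noncomputable def truncatedBoxCount (A : Set (EuclideanSpace ℝ (Fin m))) (x : ℝ) : ℝ :=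
  if boxCountJump A 0 < x then boxCount A x else 0

theorem truncatedBoxCount_nonneg (A : Set (EuclideanSpace ℝ (Fin m))) (x : ℝ) :
    0 ≤ truncatedBoxCount A x := by
  unfold truncatedBoxCount
  split_ifs <;> positivity

theorem truncatedBoxCount_monotone (hA : Bornology.IsBounded A) (hi : A.Infinite) :
    Monotone (truncatedBoxCount A) := by
  intro x y hxy
  by_cases hx : boxCountJump A 0 < x
  · simp only [truncatedBoxCount, if_pos hx, if_pos (hx.trans_le hxy)]
    exact_mod_cast boxCount_mono hA ((boxCountJump_pos hA hi 0).trans hx) hxy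
  · simp only [truncatedBoxCount, if_neg hx]
    exact truncatedBoxCount_nonneg A y

/-- The geometric counting function of the box-counting string is the truncated box-counting
function. -/
theorem hasSum_mult_boxCountingString (hA : Bornology.IsBounded A) (hi : A.Infinite) (x : ℝ) :
    HasSum (fun n => if boxCountJump A n < x then ((boxCountingString A hA hi).mult n : ℝ) else 0)
      (truncatedBoxCount A x) := by
  have hmono := boxCountJump_strictMono hA hi
  classical
  by_cases hx : boxCountJump A 0 < x
  · have hex : ∃ k, x ≤ boxCountJump A k :=
      ((tendsto_boxCountJump hA hi).eventually_ge_atTop x).exists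
    obtain ⟨n, hn⟩ : ∃ n, Nat.find hex = n + 1 := by
      refine Nat.exists_eq_add_one_of_ne_zero fun h => ?_
      have := Nat.find_spec hex
      rw [h] at this
      exact absurd this (not_le.2 hx)
    have h1 : x ≤ boxCountJump A (n + 1) := hn ▸ Nat.find_spec hex
    have h2 : boxCountJump A n < x :=
      not_le.1 (Nat.find_min hex (show n < Nat.find hex by omega))
    have hval : truncatedBoxCount A x =
        ∑ l ∈ Finset.range (n + 1),
          if boxCountJump A l < x then ((boxCountingString A hA hi).mult l : ℝ) else 0 := by
      rw [truncatedBoxCount, if_pos hx, le_antisymm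
        (boxCount_le_value hA hi ((boxCountJump_pos hA hi 0).trans hx) h1)
        (value_succ_le_boxCount hA hi h2), ← sum_mult_boxCountingString hA hi, Nat.cast_sum]
      refine Finset.sum_congr rfl fun l hl => (if_pos ?_).symm
      exact (hmono.monotone (Nat.lt_succ_iff.1 (Finset.mem_range.1 hl))).trans_lt h2
    rw [hval]
    refine hasSum_sum_of_ne_finset_zero fun l hl => if_neg (not_lt.2 ?_)
    exact h1.trans (hmono.monotone (by simpa using hl))
  · rw [truncatedBoxCount, if_neg hx]
    convert hasSum_zero using 2 with n
    exact if_neg fun h => hx ((hmono.monotone (Nat.zero_le n)).trans_lt h)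

theorem locallyIntegrable_ofReal {f : ℝ → ℝ} (hf : LocallyIntegrable f) :
    LocallyIntegrable fun x => (f x : ℂ) := by
  intro x
  obtain ⟨u, hu, h⟩ := hf x
  exact ⟨u, hu, h.ofReal⟩

theorem locallyIntegrable_truncatedBoxCount (hA : Bornology.IsBounded A) (hi : A.Infinite) {r : ℝ}
    (hr : 0 ≤ r) : LocallyIntegrable fun x => (truncatedBoxCount A (r * x) : ℂ) :=
  locallyIntegrable_ofReal (f := fun x => truncatedBoxCount A (r * x))
    (Monotone.locallyIntegrable fun _ _ h =>
      truncatedBoxCount_monotone hA hi (mul_le_mul_of_nonneg_left h hr))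

theorem mellinConvergent_truncatedBoxCount (hA : Bornology.IsBounded A) (hi : A.Infinite) {d : ℝ}
    (hO : (truncatedBoxCount A) =O[atTop] fun x => x ^ d) {s : ℂ} (hs : d < s.re) :
    MellinConvergent (fun x => (truncatedBoxCount A x : ℂ)) (-s) := by
  -- Near 0 the function vanishes, so any exponent b < -Re s serves there; only growth at infinity
  -- restricts s.
  refine mellinConvergent_of_isBigO_rpow (a := -d) (b := -s.re - 1) ?_ ?_ ?_ ?_ ?_
  · simpa using (locallyIntegrable_truncatedBoxCount hA hi zero_le_one).locallyIntegrableOn (Ioi 0)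
  · rw [neg_neg]
    exact Complex.isBigO_ofReal_left.2 hO
  · simpa using hs
  · refine Asymptotics.IsBigO.of_bound 0 ?_
    filter_upwards [nhdsWithin_le_nhds (gt_mem_nhds (boxCountJump_pos hA hi 0))] with x hx
    have hx' : x < boxCountJump A 0 := hx
    simp [truncatedBoxCount, hx'.not_gt]
  · simp only [Complex.neg_re]
    linarith

theorem integral_Ioi_cpow_mul_ite {y : ℝ} (hy : 0 < y) (c : ℝ) {s : ℂ} (hs : 0 < s.re) :
    Integrable (fun x : ℝ => (x : ℂ) ^ (-s - 1) • ((if y < x then c else 0 : ℝ) : ℂ))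
      (volume.restrict (Ioi 0)) ∧
    ∫ x in Ioi (0 : ℝ), (x : ℂ) ^ (-s - 1) • ((if y < x then c else 0 : ℝ) : ℂ) =
      s⁻¹ * (c * ((y⁻¹ : ℝ) : ℂ) ^ s) := by
  have hre : (-s - 1).re < -1 := by
    simp only [Complex.sub_re, Complex.neg_re, Complex.one_re]
    linarith
  have hfun : (fun x : ℝ => (x : ℂ) ^ (-s - 1) • ((if y < x then c else 0 : ℝ) : ℂ)) =
      (Ioi y).indicator fun x : ℝ => (x : ℂ) ^ (-s - 1) * c := by
    ext x
    by_cases hx : y < x <;> simp [hx]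
  rw [hfun]
  constructor
  · refine Integrable.restrict ?_
    rw [integrable_indicator_iff measurableSet_Ioi]
    exact (integrableOn_Ioi_cpow_of_lt hre hy).mul_const _
  · rw [setIntegral_indicator measurableSet_Ioi, Ioi_inter_Ioi, max_eq_right hy.le,
      integral_mul_const, integral_Ioi_cpow_of_lt hre hy, sub_add_cancel, neg_div_neg_eq,
      Complex.ofReal_inv, Complex.inv_cpow _ _ (by simp [Complex.arg_ofReal_of_nonneg hy.le,
        Real.pi_ne_zero.symm]), Complex.cpow_neg]
    ring

/-- Summation by parts: the counting function is a sum of step functions starting at the jumps, and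
each has Mellin transform s⁻¹ m_n l_n ^ s at -s. -/
theorem hasSum_zeta_boxCountingString (hA : Bornology.IsBounded A) (hi : A.Infinite) {d : ℝ}
    (hO : (truncatedBoxCount A) =O[atTop] fun x => x ^ d) {s : ℂ} (hs : d < s.re)
    (hs0 : 0 < s.re) :
    HasSum (fun n => ((boxCountingString A hA hi).mult n : ℂ) *
        ((boxCountingString A hA hi).len n : ℂ) ^ s)
      (s * mellin (fun x => (truncatedBoxCount A x : ℂ)) (-s)) := by
  set μ := volume.restrict (Ioi (0 : ℝ))
  set c : ℕ → ℝ := fun n => (boxCountingString A hA hi).mult n with hc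
  set G : ℕ → ℝ → ℂ := fun n x =>
    (x : ℂ) ^ (-s - 1) • ((if boxCountJump A n < x then c n else 0 : ℝ) : ℂ) with hG
  have hint : ∀ n, Integrable (G n) μ := fun n =>
    (integral_Ioi_cpow_mul_ite (boxCountJump_pos hA hi n) (c n) hs0).1
  have hconv : Integrable (fun x : ℝ => (x : ℂ) ^ (-s - 1) • (truncatedBoxCount A x : ℂ)) μ :=
    mellinConvergent_truncatedBoxCount hA hi hO hs
  have hnonneg : ∀ n x, 0 ≤ if boxCountJump A n < x then c n else 0 := by
    intro n x
    split_ifs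
    exacts [Nat.cast_nonneg _, le_rfl]
  -- Partial sums of the nonnegative steps stay below the counting function, whose Mellin integral
  -- converges absolutely; this permits exchanging sum and integral.
  have hsum : Summable fun n => ∫ x, ‖G n x‖ ∂μ := by
    refine summable_of_sum_range_le
      (c := ∫ x : ℝ, ‖(x : ℂ) ^ (-s - 1) • (truncatedBoxCount A x : ℂ)‖ ∂μ)
      (fun n => integral_nonneg fun x => norm_nonneg _) fun k => ?_
    rw [← integral_finsetSum _ fun n _ => (hint n).norm]
    refine integral_mono (integrable_finsetSum _ fun n _ => (hint n).norm) hconv.norm fun x => ?_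
    simp only [hG, norm_smul, Complex.norm_real, ← Finset.mul_sum]
    refine mul_le_mul_of_nonneg_left ?_ (norm_nonneg _)
    rw [Real.norm_of_nonneg (truncatedBoxCount_nonneg A x)]
    simp only [Real.norm_of_nonneg (hnonneg _ x)]
    exact sum_le_hasSum _ (fun n _ => hnonneg n x) (hasSum_mult_boxCountingString hA hi x)
  have h := hasSum_integral_of_summable_integral_norm hint hsum
  have htsum : ∀ x, ∑' n, G n x = (x : ℂ) ^ (-s - 1) • (truncatedBoxCount A x : ℂ) := by
    intro x
    exact ((Complex.hasSum_ofReal.2 (hasSum_mult_boxCountingString hA hi x)).const_smul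
      ((x : ℂ) ^ (-s - 1))).tsum_eq
  simp only [htsum] at h
  have hs0' : s ≠ 0 := by
    rintro rfl
    simp at hs0
  have hterm : (fun n => ((boxCountingString A hA hi).mult n : ℂ) *
      ((boxCountingString A hA hi).len n : ℂ) ^ s) = fun n => s * ∫ x, G n x ∂μ := by
    ext n
    rw [(integral_Ioi_cpow_mul_ite (boxCountJump_pos hA hi n) (c n) hs0).2,
      mul_inv_cancel_left₀ hs0']
    rw [hc, Complex.ofReal_natCast]
    rfl
  rw [hterm]
  exact h.mul_left s

theorem summable_boxCountingString (hA : Bornology.IsBounded A) (hi : A.Infinite) {d : ℝ}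
    (hO : (truncatedBoxCount A) =O[atTop] fun x => x ^ d) {α : ℝ} (hα : d < α) (hα0 : 0 < α) :
    Summable fun n => ((boxCountingString A hA hi).mult n : ℝ) *
      (boxCountingString A hA hi).len n ^ α := by
  have h := (hasSum_zeta_boxCountingString hA hi hO (s := α) (by simpa using hα)
    (by simpa using hα0)).summable
  rw [← Complex.summable_ofReal]
  convert h using 2 with n
  rw [Complex.ofReal_mul, Complex.ofReal_natCast,
    Complex.ofReal_cpow ((boxCountingString A hA hi).len_pos n).le]

/-- A Markov-type bound: each length counted at x satisfies l_n x > 1, so its multiplicity is at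
most m_n (l_n x) ^ β. This needs β ≥ 0, whereas α may be negative. -/
theorem exists_boxCount_le_of_summable (hA : Bornology.IsBounded A) (hi : A.Infinite) {α β : ℝ}
    (hα : Summable fun n => ((boxCountingString A hA hi).mult n : ℝ) *
      (boxCountingString A hA hi).len n ^ α) (hαβ : α ≤ β) (hβ : 0 ≤ β) :
    ∃ S, ∀ x, boxCountJump A 0 < x → (boxCount A x : ℝ) ≤ S * x ^ β := by
  set L := boxCountingString A hA hi
  have hsum : Summable fun n => (L.mult n : ℝ) * L.len n ^ β := by
    refine Summable.of_norm_bounded_eventually_nat hα ?_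
    filter_upwards [L.len_tendsto.eventually (gt_mem_nhds one_pos)] with n hn
    rw [Real.norm_of_nonneg (mul_nonneg (Nat.cast_nonneg _) (Real.rpow_nonneg (L.len_pos n).le _))]
    exact mul_le_mul_of_nonneg_left
      (Real.rpow_le_rpow_of_exponent_ge (L.len_pos n) hn.le hαβ) (Nat.cast_nonneg _)
  refine ⟨∑' n, (L.mult n : ℝ) * L.len n ^ β, fun x hx => ?_⟩
  have hx0 : 0 < x := (boxCountJump_pos hA hi 0).trans hx
  have h := hasSum_mult_boxCountingString hA hi x
  rw [truncatedBoxCount, if_pos hx] at h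
  refine hasSum_le (fun n => ?_) h (hsum.hasSum.mul_right (x ^ β))
  have hl := L.len_pos n
  split_ifs with hn
  · rw [mul_assoc, ← Real.mul_rpow hl.le hx0.le]
    refine le_mul_of_one_le_right (Nat.cast_nonneg _) (Real.one_le_rpow ?_ hβ)
    change 1 ≤ (boxCountJump A n)⁻¹ * x
    rw [inv_mul_eq_div, one_le_div (boxCountJump_pos hA hi n)]
    exact hn.le
  · exact mul_nonneg (mul_nonneg (Nat.cast_nonneg _) (Real.rpow_nonneg hl.le _))
      (Real.rpow_nonneg hx0.le _)

end BoxCountingString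

/-! ### Poles and meromorphic extensions -/

theorem not_hasPole_of_analyticAt {g : ℂ → ℂ} {ω : ℂ} (h : AnalyticAt ℂ g ω) : ¬ HasPole g ω :=
  fun hp => absurd h.meromorphicOrderAt_nonneg (not_le.2 hp.2)

/-- Two functions that are meromorphic at a point on the boundary of a right half-plane and agree
on that half-plane have the same order at the point. -/
theorem meromorphicOrderAt_eq_of_eq_of_lt_re {g h : ℂ → ℂ} {ω : ℂ} (hg : MeromorphicAt g ω)
    (hh : MeromorphicAt h ω) (heq : ∀ s : ℂ, ω.re < s.re → g s = h s) :
    meromorphicOrderAt g ω = meromorphicOrderAt h ω := by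
  have ht : Tendsto (fun t : ℝ => ω + t) (𝓝[>] 0) (𝓝[≠] ω) := by
    refine tendsto_nhdsWithin_iff.2 ⟨?_, ?_⟩
    · have : Tendsto (fun t : ℝ => ω + t) (𝓝 0) (𝓝 (ω + (0 : ℝ))) :=
        (continuous_const.add Complex.continuous_ofReal).tendsto 0
      rw [Complex.ofReal_zero, add_zero] at this
      exact this.mono_left nhdsWithin_le_nhds
    · filter_upwards [self_mem_nhdsWithin] with t ht
      have : t ≠ 0 := ne_of_gt ht
      simpa using this
  -- The difference vanishes along a horizontal ray ending at ω, and zeros of a meromorphic function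
  -- accumulating at a point force it to vanish nearby.
  have hfr : ∃ᶠ z in 𝓝[≠] ω, (g - h) z = 0 := by
    refine ht.frequently (Eventually.frequently ?_)
    filter_upwards [self_mem_nhdsWithin] with t ht
    have ht : 0 < t := ht
    simp only [Pi.sub_apply, sub_eq_zero]
    exact heq _ (by simpa using ht)
  refine meromorphicOrderAt_congr ?_
  filter_upwards [(hg.sub hh).frequently_zero_iff_eventuallyEq_zero.1 hfr] with z hz
  exact sub_eq_zero.1 hz

/-- Among the vertical lines in a strip there is one without a pole of a function that is
meromorphic in the strip. -/
theorem exists_line_analyticAt {g : ℂ → ℂ} {a b : ℝ} (hab : a < b)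
    (hg : MeromorphicOn g {s : ℂ | a < s.re}) :
    ∃ c ∈ Ioo a b, ∀ s : ℂ, s.re = c → AnalyticAt ℂ g s := by
  -- The points of non-analyticity are countable, so their real parts have a dense complement.
  obtain ⟨c, hc, hcab⟩ :=
    ((hg.countable_compl_analyticAt_inter.image Complex.re).dense_compl ℝ).exists_between hab
  refine ⟨c, hcab, fun s hs => ?_⟩
  by_contra hna
  refine hc ⟨s, ⟨hna, ?_⟩, hs⟩
  change a < s.re
  exact hs ▸ hcab.1

/-! ### Meromorphic continuation of the zeta function of the attractor -/

namespace SelfSimilarSystem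

open MeasureTheory

variable {m N : ℕ} {Φ : SelfSimilarSystem m N} {F : Set (EuclideanSpace ℝ (Fin m))}

theorem sum_ratio_cpow_ne_one {D : ℝ} (hD : ∑ j, Φ.ratio j ^ D = 1) {s : ℂ} (hs : D < s.re) :
    ∑ j, (Φ.ratio j : ℂ) ^ s ≠ 1 := by
  intro h
  have h1 : ‖∑ j, (Φ.ratio j : ℂ) ^ s‖ ≤ ∑ j, Φ.ratio j ^ s.re :=
    (norm_sum_le _ _).trans_eq (Finset.sum_congr rfl fun j _ =>
      Complex.norm_cpow_eq_rpow_re_of_pos (Φ.ratio_pos j) s)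
  have h2 := Φ.strictAnti_sum_ratio_rpow hs
  rw [h, norm_one] at h1
  simp only [hD] at h2
  linarith

theorem analyticAt_sum_ratio_cpow (s : ℂ) :
    AnalyticAt ℂ (fun s : ℂ => ∑ j, (Φ.ratio j : ℂ) ^ s) s := by
  have hd : Differentiable ℂ fun s : ℂ => ∑ j, (Φ.ratio j : ℂ) ^ s := by
    refine Differentiable.fun_sum fun j _ s => ?_
    exact differentiableAt_id.const_cpow
      (Or.inl (Complex.ofReal_ne_zero.2 (Φ.ratio_pos j).ne'))
  exact hd.analyticAt s

/-- The error in the renewal equation of the truncated box-counting function. -/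
noncomputable def renewalError (Φ : SelfSimilarSystem m N)
    (F : Set (EuclideanSpace ℝ (Fin m))) (x : ℝ) : ℝ :=
  ∑ j, truncatedBoxCount F (Φ.ratio j * x) - truncatedBoxCount F x

theorem IsAttractor.isBigO_truncatedBoxCount (hF : Φ.IsAttractor F) {D : ℝ} (hD0 : 0 ≤ D)
    (hD : ∑ j, Φ.ratio j ^ D = 1) : (truncatedBoxCount F) =O[atTop] fun x => x ^ D := by
  obtain ⟨K, hK, h⟩ := hF.exists_boxCount_le_rpow hD0 hD
  refine Asymptotics.IsBigO.of_bound K ?_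
  filter_upwards [eventually_ge_atTop 1] with x hx
  have hpow : 0 ≤ x ^ D := Real.rpow_nonneg (by linarith) D
  rw [Real.norm_of_nonneg (truncatedBoxCount_nonneg F x), Real.norm_of_nonneg hpow,
    truncatedBoxCount]
  split_ifs
  · exact h x hx
  · exact mul_nonneg hK hpow

theorem OpenSetCondition.exists_isBigO_renewalError (hΦ : Φ.OpenSetCondition)
    (hF : Φ.IsAttractor F) {D : ℝ} (hD0 : 0 < D) (hD : ∑ j, Φ.ratio j ^ D = 1) :
    ∃ d, 0 < d ∧ d < D ∧ (Φ.renewalError F) =O[atTop] fun x => x ^ d := by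
  obtain ⟨d, K, x₀, hd0, hdD, hx₀, h⟩ := hΦ.exists_sum_boxCount_sub_le hF hD0 hD
  refine ⟨d, hd0, hdD, Asymptotics.IsBigO.of_bound K ?_⟩
  have hlarge : ∀ᶠ x in (atTop : Filter ℝ), ∀ j, boxCountJump F 0 < Φ.ratio j * x :=
    eventually_all.2 fun j =>
      (tendsto_id.const_mul_atTop (Φ.ratio_pos j)).eventually_gt_atTop _
  filter_upwards [eventually_ge_atTop x₀, hlarge, eventually_gt_atTop (boxCountJump F 0)]
    with x hx hj hx'
  rw [Real.norm_of_nonneg (Real.rpow_nonneg (hx₀.le.trans hx) d), Real.norm_eq_abs, renewalError]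
  simp only [truncatedBoxCount, if_pos (hj _), if_pos hx']
  exact h x hx

/-- The error vanishes near 0 and is O(x ^ d) at infinity, so its transform is holomorphic for Re s
> d; with d < D this is where the continuation comes from. -/
theorem differentiableAt_mellin_renewalError (hF : Bornology.IsBounded F) (hi : F.Infinite)
    {d : ℝ} (hO : (Φ.renewalError F) =O[atTop] fun x => x ^ d) {s : ℂ} (hs : d < s.re) :
    DifferentiableAt ℂ (fun s => mellin (fun x => (Φ.renewalError F x : ℂ)) (-s)) s := by
  have hloc : LocallyIntegrable fun x => (Φ.renewalError F x : ℂ) := by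
    have h1 : LocallyIntegrable fun x => ∑ j, (truncatedBoxCount F (Φ.ratio j * x) : ℂ) :=
      locallyIntegrable_finsetSum _ fun j _ =>
        locallyIntegrable_truncatedBoxCount hF hi (Φ.ratio_pos j).le
    have h2 := locallyIntegrable_truncatedBoxCount hF hi zero_le_one
    simp only [one_mul] at h2
    simpa [renewalError, Pi.sub_def] using h1.sub h2
  have hdiff : DifferentiableAt ℂ (mellin fun x => (Φ.renewalError F x : ℂ)) (-s) := by
    refine mellin_differentiableAt_of_isBigO_rpow (a := -d) (b := -s.re - 1)
      (hloc.locallyIntegrableOn _) ?_ (by simpa using hs) ?_ ?_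
    · rw [neg_neg]
      exact Complex.isBigO_ofReal_left.2 hO
    · refine Asymptotics.IsBigO.of_bound 0 ?_
      filter_upwards [nhdsWithin_le_nhds (gt_mem_nhds (boxCountJump_pos hF hi 0)),
        self_mem_nhdsWithin] with x hx hx0
      have hx : x < boxCountJump F 0 := hx
      have hj : ∀ j, ¬ boxCountJump F 0 < Φ.ratio j * x := fun j =>
        not_lt.2 ((mul_le_of_le_one_left (le_of_lt hx0) (Φ.ratio_lt_one j).le).trans hx.le)
      simp [renewalError, truncatedBoxCount, hx.not_gt, hj]
    · simp only [Complex.neg_re]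
      linarith
  exact hdiff.comp s differentiableAt_id.neg

/-- The renewal equation for the Mellin transform of the box-counting function. -/
theorem mellin_renewalError (hF : Bornology.IsBounded F) (hi : F.Infinite) {D : ℝ}
    (hO : (truncatedBoxCount F) =O[atTop] fun x => x ^ D) {s : ℂ} (hs : D < s.re) :
    mellin (fun x => (Φ.renewalError F x : ℂ)) (-s) =
      (∑ j, (Φ.ratio j : ℂ) ^ s - 1) * mellin (fun x => (truncatedBoxCount F x : ℂ)) (-s) := by
  have hconv := mellinConvergent_truncatedBoxCount hF hi hO hs
  have hj : ∀ j, MellinConvergent (fun x => (truncatedBoxCount F (Φ.ratio j * x) : ℂ)) (-s) :=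
    fun j => (MellinConvergent.comp_mul_left (Φ.ratio_pos j)).2 hconv
  have hmj : ∀ j, mellin (fun x => (truncatedBoxCount F (Φ.ratio j * x) : ℂ)) (-s) =
      (Φ.ratio j : ℂ) ^ s * mellin (fun x => (truncatedBoxCount F x : ℂ)) (-s) := by
    intro j
    have := mellin_comp_mul_left (fun x => (truncatedBoxCount F x : ℂ)) (-s) (Φ.ratio_pos j)
    rwa [neg_neg, smul_eq_mul] at this
  rw [sub_mul, one_mul, Finset.sum_mul, ← Finset.sum_congr rfl fun j _ => hmj j]
  simp only [mellin, renewalError, Complex.ofReal_sub, Complex.ofReal_sum, smul_sub,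
    Finset.smul_sum]
  rw [integral_sub (integrable_finsetSum _ fun j _ => hj j) hconv,
    integral_finsetSum _ fun j _ => hj j]

/-- The meromorphic extension of the zeta function of the box-counting string of the attractor. -/
noncomputable def zetaExtension (Φ : SelfSimilarSystem m N)
    (F : Set (EuclideanSpace ℝ (Fin m))) (s : ℂ) : ℂ :=
  s * mellin (fun x => (Φ.renewalError F x : ℂ)) (-s) / (∑ j, (Φ.ratio j : ℂ) ^ s - 1)

theorem zetaExtension_eq_zeta (hF : Bornology.IsBounded F) (hi : F.Infinite) {D : ℝ} (hD0 : 0 ≤ D)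
    (hD : ∑ j, Φ.ratio j ^ D = 1) (hO : (truncatedBoxCount F) =O[atTop] fun x => x ^ D) {s : ℂ}
    (hs : D < s.re) : Φ.zetaExtension F s = (boxCountingString F hF hi).zeta s := by
  rw [FractalString.zeta, (hasSum_zeta_boxCountingString hF hi hO hs (hD0.trans_lt hs)).tsum_eq,
    zetaExtension, mellin_renewalError hF hi hO hs, mul_left_comm,
    mul_div_cancel_left₀ _ (sub_ne_zero.2 (sum_ratio_cpow_ne_one hD hs))]

theorem analyticAt_mul_mellin_renewalError (hF : Bornology.IsBounded F) (hi : F.Infinite)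
    {d : ℝ} (hO : (Φ.renewalError F) =O[atTop] fun x => x ^ d) {s : ℂ} (hs : d < s.re) :
    AnalyticAt ℂ (fun s => s * mellin (fun x => (Φ.renewalError F x : ℂ)) (-s)) s := by
  have hopen : IsOpen {z : ℂ | d < z.re} := isOpen_lt continuous_const Complex.continuous_re
  refine analyticAt_id.mul (DifferentiableOn.analyticAt (s := {z : ℂ | d < z.re}) (fun z hz => ?_)
    (hopen.mem_nhds hs))
  exact (differentiableAt_mellin_renewalError hF hi hO hz).differentiableWithinAt

theorem meromorphicOn_zetaExtension (hF : Bornology.IsBounded F) (hi : F.Infinite)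
    {d : ℝ} (hO : (Φ.renewalError F) =O[atTop] fun x => x ^ d) :
    MeromorphicOn (Φ.zetaExtension F) {s : ℂ | d < s.re} := fun s hs =>
  (analyticAt_mul_mellin_renewalError hF hi hO hs).meromorphicAt.div
    ((analyticAt_sum_ratio_cpow s).sub analyticAt_const).meromorphicAt

theorem analyticAt_zetaExtension (hF : Bornology.IsBounded F) (hi : F.Infinite)
    {d : ℝ} (hO : (Φ.renewalError F) =O[atTop] fun x => x ^ d) {s : ℂ} (hs : d < s.re)
    (hne : ∑ j, (Φ.ratio j : ℂ) ^ s ≠ 1) : AnalyticAt ℂ (Φ.zetaExtension F) s :=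
  (analyticAt_mul_mellin_renewalError hF hi hO hs).div
    ((analyticAt_sum_ratio_cpow s).sub analyticAt_const) (sub_ne_zero.2 hne)

/-- The dimension of the box-counting string of the attractor is the similarity dimension. -/
theorem OpenSetCondition.dimension_boxCountingString (hΦ : Φ.OpenSetCondition)
    (hF : Φ.IsAttractor F) (hi : F.Infinite) {D : ℝ} (hD0 : 0 < D)
    (hD : ∑ j, Φ.ratio j ^ D = 1) :
    (boxCountingString F hF.isCompact.isBounded hi).dimension = (D : EReal) := by
  have hO := hF.isBigO_truncatedBoxCount hD0.le hD
  apply le_antisymm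
  · refine EReal.le_of_forall_lt_iff_le.1 fun z hz => sInf_le ⟨z, ?_, rfl⟩
    have hz : D < z := EReal.coe_lt_coe_iff.1 hz
    exact summable_boxCountingString _ hi hO hz (hD0.trans hz)
  · refine le_sInf ?_
    rintro _ ⟨α, hα, rfl⟩
    rw [EReal.coe_le_coe_iff]
    by_contra! hlt
    -- Convergence at α < D would give N(x) ≤ S x ^ max(α, 0), against N(x) ≥ c x ^ β with a larger
    -- exponent β < D.
    obtain ⟨β, hβ1, hβ2⟩ := exists_between (max_lt hlt hD0)
    obtain ⟨S, hS⟩ := exists_boxCount_le_of_summable hF.isCompact.isBounded hi hα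
      (le_max_left α 0) (le_max_right α 0)
    have hsum : 1 < ∑ j, Φ.ratio j ^ β := by
      have := Φ.strictAnti_sum_ratio_rpow hβ2
      simpa only [hD] using this
    obtain ⟨c, hc, hcx⟩ :=
      hΦ.exists_rpow_le_boxCount hF ((le_max_right α 0).trans hβ1.le) hsum
    obtain ⟨x, hx1, hx2, hx3⟩ :=
      (((tendsto_rpow_atTop (sub_pos.2 hβ1)).eventually_gt_atTop (S / c)).and
        ((eventually_gt_atTop (boxCountJump F 0)).and (eventually_gt_atTop 0))).exists
    have h := (hcx x hx3).trans (hS x hx2)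
    rw [div_lt_iff₀ hc] at hx1
    have hsplit : x ^ β = x ^ (β - max α 0) * x ^ max α 0 := by
      rw [← Real.rpow_add hx3, sub_add_cancel]
    rw [hsplit, ← mul_assoc] at h
    have := le_of_mul_le_mul_right h (Real.rpow_pos_of_pos hx3 _)
    linarith

end SelfSimilarSystem

theorem mainTheorem5 {m N : ℕ} (Φ : SelfSimilarSystem m N) (hΦ : Φ.OpenSetCondition)
    (F : Set (EuclideanSpace ℝ (Fin m))) (hF : Φ.IsAttractor F) :
    ∃ hinf : F.Infinite,
      (∃ D : ℝ, IsSimilarityDimension Φ.ratio D ∧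
        (boxCountingString F hF.isCompact.isBounded hinf).dimension = (D : EReal)) ∧
      (∃ (f : ℝ → EReal) (U : Set ℂ) (g : ℂ → ℂ),
        (boxCountingString F hF.isCompact.isBounded hinf).IsAdmissible f U g) ∧
      ∀ (f : ℝ → EReal) (U : Set ℂ) (g : ℂ → ℂ),
        (boxCountingString F hF.isCompact.isBounded hinf).IsAdmissible f U g →
        (boxCountingString F hF.isCompact.isBounded hinf).principalComplexDimensions f g ⊆
          moranSolutions Φ.ratio := by
  have hi := hΦ.infinite hF
  obtain ⟨D, hD0, hD⟩ := Φ.exists_isSimilarityDimension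
  have hdim := hΦ.dimension_boxCountingString hF hi hD0 hD
  have hO := hF.isBigO_truncatedBoxCount hD0.le hD
  obtain ⟨d, -, hdD, hE⟩ := hΦ.exists_isBigO_renewalError hF hD0 hD
  have hb := hF.isCompact.isBounded
  have hmero := SelfSimilarSystem.meromorphicOn_zetaExtension hb hi hE
  refine ⟨hi, ⟨D, ⟨hD0.le, hD⟩, hdim⟩, ?_, ?_⟩
  · obtain ⟨c, ⟨hdc, hcD⟩, hc⟩ := exists_line_analyticAt hdD hmero
    refine ⟨fun _ => (c : EReal), {s : ℂ | d < s.re}, Φ.zetaExtension F, ?_⟩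
    exact
      { continuous := continuous_const
        le_dimension := fun _ => by rw [hdim]; exact EReal.coe_le_coe_iff.2 hcD.le
        isOpen := isOpen_lt continuous_const Complex.continuous_re
        isConnected := ⟨⟨(D : ℂ), by simpa using hdD⟩,
          (convex_halfSpace_re_gt d).isPreconnected⟩
        window_subset := fun s hs => hdc.trans_le (EReal.coe_le_coe_iff.1 hs)
        meromorphicOn := hmero
        eq_zeta := fun s hs => by
          rw [hdim, EReal.coe_lt_coe_iff] at hs
          exact SelfSimilarSystem.zetaExtension_eq_zeta hb hi hD0.le hD hO hs
        no_pole := fun s hs => not_hasPole_of_analyticAt (hc s (EReal.coe_eq_coe_iff.1 hs)) }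
  · rintro f U g hadm ω ⟨⟨hω, hgmero, hgord⟩, hre⟩
    rw [hdim, EReal.coe_eq_coe_iff] at hre
    by_contra hne
    have hdω : d < ω.re := hre ▸ hdD
    -- The domain `U` need not lie in Re s > d; the comparison at ω only uses agreement to the right
    -- of the line Re s = D.
    have horder := meromorphicOrderAt_eq_of_eq_of_lt_re hgmero (hmero ω hdω) fun s hs => by
      rw [hre] at hs
      rw [hadm.eq_zeta s (by rw [hdim]; exact EReal.coe_lt_coe_iff.2 hs),
        SelfSimilarSystem.zetaExtension_eq_zeta hb hi hD0.le hD hO hs]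
    rw [horder] at hgord
    have hana := SelfSimilarSystem.analyticAt_zetaExtension hb hi hE hdω hne
    exact absurd hana.meromorphicOrderAt_nonneg (not_le.2 hgord)
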